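/- A (finitary algebraic) theory is a category $\mathbb T$ with objects $X^0,X^1,X^2,\dots$ together with an identity-on-objects, finite-product-preserving functor from the opposite of the category of the finite sets $\{1,\dots,n\}$, $n\ge 0$; morphisms of theories are identity-on-objects functors commuting with these structure functors. The elements of $\hom_{\mathbb T}(X^n,X)$ are the $n$-ary operations of $\mathbb T$, and a model is a finite-product-preserving functor $\mathbb T\to\mathbf{Set}$. A theory is Maltsev if it has a ternary operation $p$ with $p(x,y,y)=x=p(y,y,x)$, and abelian if every model $A$ satisfies $[\nabla_A,\nabla_A]=\Delta_A$. Here $\nabla_A$ and $\Delta_A$ are the largest and the smallest congruence on $A$; for congruences $R,S$ on $A$, the commutator $[R,S]$ consists of all pairs $(b,d)$ such that for some $a$ the pairs $(a,b)$ and $(a,d)$ lie in $R$ and are related by the smallest congruence on the model $R\subseteq A\times A$ that relates $(x,x)$ to $(y,y)$ for all $(x,y)\in S$. A left linear form is a homomorphism $\partial:M\to R$ of left $R$-modules, where $R$ is an associative unital ring. A morphism from $\partial:M\to R$ to $\partial':M'\to R'$ is a pair $(f,g)$ of a unital ring homomorphism $f:R\to R'$ and an additive map $g:M\to M'$ with $g(rx)=f(r)g(x)$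 and $\partial' g=f\partial$. These form the category $\mathbf{Lf}$. An affinity over $\partial$ is a set $A$ with operations $b+_ac$, $r_ab$, $\varphi_a(x)$ (for $a,b,c\in A$, $r\in R$, $x\in M$) such that $m(x,y,z)=x+_yz$ satisfies $m(x,y,y)=x=m(y,y,x)$, $m(u,v,m(x,y,z))=m(m(u,v,x),y,z)$ and $m(x,y,z)=m(z,y,x)$; each $a\in A$ makes $A$, with $+_a$ and $(r,b)\mapsto r_ab$, a left $R$-module with zero $a$ for which $\varphi_a:M\to A$ is $R$-linear; and, with $b-_ac=b+_a((-1)_ac)$, $$b+_{a'}c=((b-_aa')+_a(c-_aa'))+_aa',\quad r_{a'}b=r_a(b-_aa')+_aa',\quad \varphi_{a'}(x)=\varphi_a(x)+_a(1-\partial x)_aa'.$$ Homomorphisms of affinities are the maps preserving all these operations. **Theorem.** (1) For every left linear form $\partial:M\to R$ there is a theory $\mathbb T_\partial$ with $\hom_{\mathbb T_\partial}(X^0,X)=\varnothing$ and $\hom_{\mathbb T_\partial}(X^n,X)=M\times R^{n-1}$ for $n>0$, whose projections $X^n\to X$ are $\langle 0,0,0,\dots\rangle$, $\langle 0,1,0,\dots\rangle$,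 $\langle 0,0,1,\dots\rangle$, ..., and whose composition is $$\langle x,r_1,r_2,\dots\rangle\big(\langle x_0,s_0,t_0,\dots\rangle,\langle x_1,s_1,t_1,\dots\rangle,\dots\big)=\langle x',s',t',\dots\rangle,$$ $$x'=x+(1-\partial x)x_0+\sum_i r_i(x_i-x_0),\quad s'=(1-\partial x)s_0+\sum_i r_i(s_i-s_0),\quad t'=(1-\partial x)t_0+\sum_i r_i(t_i-t_0),\ \dots$$ It is the theory of affinities over $\partial$: on every set, the model structures of $\mathbb T_\partial$ and the affinity structures over $\partial$ correspond bijectively via $b+_ac=\langle 0,1,1\rangle(a,b,c)$, $r_ab=\langle 0,r\rangle(a,b)$, $\varphi_a(x)=\langle x\rangle(a)$, and the two kinds of structure have the same homomorphisms. (2) Every $\mathbb T_\partial$ is an abelian Maltsev theory without nullary operations, and the functor $\partial\mapsto\mathbb T_\partial$, which sends a morphism $(f,g)$ to $\langle x,r_1,r_2,\dots\rangle\mapsto\langle g(x),f(r_1),f(r_2),\dots\rangle$, is an equivalence from $\mathbf{Lf}$ to the category of abelian Maltsev theories without nullary operations (a full subcategory of the category of theories). -/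

import Mathlib

open CategoryTheory

universe u v w

/-! ## Finitary algebraic theories -/

/-- A finitary algebraic theory: a category with objects `X^0, X^1, X^2, …` (the object `X^n` is
written `n`), together with an identity-on-objects functor `str` from the opposite of the category
of the finite sets `Fin n`, such that `str` preserves finite products, i.e. every `X^k` is, by means
of the images of the `k` projections, the product of `k` copies of `X = X^1`.
Composition is written in diagrammatic order. -/
structure AlgTheory where
  /-- the morphisms `X^n ⟶ X^k` -/
  Hom : ℕ → ℕ → Type u
  id : ∀ n, Hom n n
  comp : ∀ {n k l}, Hom n k → Hom k l → Hom n l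
  id_comp : ∀ {n k} (f : Hom n k), comp (id n) f = f
  comp_id : ∀ {n k} (f : Hom n k), comp f (id k) = f
  assoc : ∀ {n k l m} (f : Hom n k) (g : Hom k l) (h : Hom l m),
    comp (comp f g) h = comp f (comp g h)
  /-- the structure functor; `str f` is the tuple of projections `(x_{f 0}, x_{f 1}, …)` -/
  str : ∀ {n k}, (Fin k → Fin n) → Hom n k
  str_id : ∀ n, str (fun i : Fin n => i) = id n
  str_comp : ∀ {n k l} (f : Fin k → Fin n) (g : Fin l → Fin k),
    comp (str f) (str g) = str (fun i => f (g i))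
  isProduct : ∀ n k, Function.Bijective
    (fun (f : Hom n k) (i : Fin k) => comp f (str (fun _ : Fin 1 => i)))

namespace AlgTheory

/-- The set `T(n) = Hom (X^n, X)` of `n`-ary operations of a theory. -/
abbrev Operation (T : AlgTheory.{u}) (n : ℕ) : Type u := T.Hom n 1

/-- A morphism of theories: an identity-on-objects functor commuting with the structure functors. -/
@[ext]
structure Morphism (S T : AlgTheory.{u}) where
  map : ∀ {n k}, S.Hom n k → T.Hom n k
  map_id : ∀ n, map (S.id n) = T.id n
  map_comp : ∀ {n k l} (f : S.Hom n k) (g : S.Hom k l),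
    map (S.comp f g) = T.comp (map f) (map g)
  map_str : ∀ {n k} (f : Fin k → Fin n), map (S.str f) = T.str f

/-- The category of finitary algebraic theories. -/
instance : Category AlgTheory.{u} where
  Hom S T := Morphism S T
  id S := ⟨fun f => f, fun _ => rfl, fun _ _ => rfl, fun _ => rfl⟩
  comp F G :=
    { map := fun f => G.map (F.map f)
      map_id := fun n => by rw [F.map_id, G.map_id]
      map_comp := fun f g => by rw [F.map_comp, G.map_comp]
      map_str := fun f => by rw [F.map_str, G.map_str] }

/-! ### Models, congruences, commutators -/

/-- A model structure for the theory `T` on the set `A`: a product preserving functor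
`X^n ↦ A^n`, i.e. an operation on `A` for every operation of `T`, compatibly with composition
and projections. -/
structure Model (T : AlgTheory.{u}) (A : Type v) where
  act : ∀ {n k}, T.Hom n k → (Fin n → A) → (Fin k → A)
  act_id : ∀ n (a : Fin n → A), act (T.id n) a = a
  act_comp : ∀ {n k l} (f : T.Hom n k) (g : T.Hom k l) (a : Fin n → A),
    act (T.comp f g) a = act g (act f a)
  act_str : ∀ {n k} (f : Fin k → Fin n) (a : Fin n → A), act (T.str f) a = fun i => a (f i)

/-- The operation on a model given by an `n`-ary operation of the theory. -/
def Model.op {T : AlgTheory.{u}} {A : Type v} (M : T.Model A) {n : ℕ} (f : T.Operation n)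
    (a : Fin n → A) : A := M.act f a 0

/-- Homomorphisms of models. -/
def IsModelHom {T : AlgTheory.{u}} {A : Type v} {B : Type w} (M : T.Model A) (N : T.Model B)
    (φ : A → B) : Prop :=
  ∀ (n : ℕ) (f : T.Operation n) (a : Fin n → A), φ (M.op f a) = N.op f (fun i => φ (a i))

/-- A congruence on a model. -/
structure Congruence {T : AlgTheory.{u}} {A : Type v} (M : T.Model A) where
  rel : A → A → Prop
  equivalence : Equivalence rel
  compat : ∀ {n k} (f : T.Hom n k) (a b : Fin n → A),
    (∀ i, rel (a i) (b i)) → ∀ j, rel (M.act f a j) (M.act f b j)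

namespace Congruence

variable {T : AlgTheory.{u}} {A : Type v} {M : T.Model A}

/-- The largest congruence. -/
def largest (M : T.Model A) : Congruence M where
  rel _ _ := True
  equivalence := ⟨fun _ => trivial, fun _ => trivial, fun _ _ => trivial⟩
  compat _ _ _ _ _ := trivial

/-- The congruence `R` regarded as a submodel of `M × M`. -/
def toModel (R : Congruence M) : T.Model {p : A × A // R.rel p.1 p.2} where
  act f p j := ⟨(M.act f (fun i => (p i).1.1) j, M.act f (fun i => (p i).1.2) j),
    R.compat f _ _ (fun i => (p i).2) j⟩
  act_id n a := by
    funext j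
    simp [M.act_id]
  act_comp f g a := by
    funext j
    simp [M.act_comp]
  act_str f a := by
    funext j
    simp [M.act_str]

/-- The smallest congruence `Δ_{R,S}` on the model `R` that relates `(x, x)` to `(y, y)` for
all `(x, y)` in `S`. -/
def delta (R S : Congruence M) (p q : {p : A × A // R.rel p.1 p.2}) : Prop :=
  ∀ C : Congruence R.toModel,
    (∀ x y, S.rel x y →
      C.rel ⟨(x, x), R.equivalence.refl x⟩ ⟨(y, y), R.equivalence.refl y⟩) →
    C.rel p q

/-- The commutator `[R, S]`: the image, under the second projection `R → M`, of the intersection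
of `Δ_{R,S}` with the kernel pair of the first projection `R → M`. -/
def commutator (R S : Congruence M) (x y : A) : Prop :=
  ∃ p q : {p : A × A // R.rel p.1 p.2},
    delta R S p q ∧ p.1.1 = q.1.1 ∧ p.1.2 = x ∧ q.1.2 = y

end Congruence

/-- A model is abelian if the commutator of the largest congruence with itself is the equality
relation. -/
def Model.IsAbelian {T : AlgTheory.{u}} {A : Type v} (M : T.Model A) : Prop :=
  ∀ x y : A, (Congruence.largest M).commutator (Congruence.largest M) x y ↔ x = y

/-- A theory is abelian if all its models (in sets) are abelian. -/
def IsAbelian (T : AlgTheory.{u}) : Prop :=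
  ∀ (A : Type u) (M : T.Model A), M.IsAbelian

/-- A Maltsev theory: there is a ternary operation `p` with `p(x,y,y) = x` and `p(x,x,y) = y`. -/
def IsMaltsev (T : AlgTheory.{u}) : Prop :=
  ∃ p : T.Operation 3,
    T.comp (T.str (n := 2) ![0, 1, 1]) p = T.str (n := 2) ![0] ∧
    T.comp (T.str (n := 2) ![0, 0, 1]) p = T.str (n := 2) ![1]

/-- A theory without nullary operations. -/
def HasNoNullary (T : AlgTheory.{u}) : Prop := IsEmpty (T.Operation 0)

/-- The abelian Maltsev theories without nullary operations. -/
def abelianMaltsev : ObjectProperty AlgTheory.{u} :=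
  fun T => T.IsAbelian ∧ T.IsMaltsev ∧ T.HasNoNullary

end AlgTheory

/-! ## Left linear forms -/

/-- A left linear form: a ring `R`, a left `R`-module `M`, and an `R`-linear map `∂ : M → R`. -/
structure LeftLinearForm where
  R : Type u
  M : Type u
  [ring : Ring R]
  [addCommGroup : AddCommGroup M]
  [module : Module R M]
  form : M →ₗ[R] R

namespace LeftLinearForm

attribute [instance] ring addCommGroup module

/-- Morphisms of left linear forms. -/
@[ext]
structure Morphism (D E : LeftLinearForm.{u}) where
  f : D.R →+* E.R
  g : D.M →+ E.M
  map_smul : ∀ (r : D.R) (x : D.M), g (r • x) = f r • g x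
  comm : ∀ x : D.M, E.form (g x) = f (D.form x)

/-- The category `Lf` of left linear forms. -/
instance : Category LeftLinearForm.{u} where
  Hom D E := Morphism D E
  id D := ⟨RingHom.id _, AddMonoidHom.id _, fun _ _ => rfl, fun _ => rfl⟩
  comp F G :=
    { f := G.f.comp F.f
      g := G.g.comp F.g
      map_smul := fun r x => by simp [F.map_smul, G.map_smul]
      comm := fun x => by simp [F.comm, G.comm] }

/-! ### The theory of a left linear form -/

/-- The `n`-ary operations `⟨x, r₁, …, r_{n-1}⟩`: no operations for `n = 0`, and
`M × R^{n-1}` for `n > 0`. -/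
def Op (D : LeftLinearForm.{u}) : ℕ → Type u
  | 0 => PEmpty
  | n + 1 => D.M × (Fin n → D.R)

/-- The projections `⟨0,0,0,…⟩, ⟨0,1,0,…⟩, ⟨0,0,1,…⟩, …`. -/
def proj (D : LeftLinearForm.{u}) : {n : ℕ} → Fin n → D.Op n
  | 0, i => i.elim0
  | _ + 1, i => (0, fun j => if j.succ = i then 1 else 0)

/-- The composition law `⟨x, r₁, r₂, …⟩ (⟨x₀, s₀, t₀, …⟩, ⟨x₁, s₁, t₁, …⟩, …) = ⟨x', s', t', …⟩`
with `x' = x + (1 - ∂x) x₀ + r₁ (x₁ - x₀) + r₂ (x₂ - x₀) + …`,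
`s' = (1 - ∂x) s₀ + r₁ (s₁ - s₀) + r₂ (s₂ - s₀) + …`, and so on. -/
def subst (D : LeftLinearForm.{u}) : {k n : ℕ} → D.Op k → (Fin k → D.Op n) → D.Op n
  | 0, _, y, _ => y.elim
  | _ + 1, 0, _, z => z 0
  | _ + 1, _ + 1, y, z =>
    (y.1 + (1 - D.form y.1) • (z 0).1 + ∑ i, y.2 i • ((z i.succ).1 - (z 0).1),
      fun j => (1 - D.form y.1) * (z 0).2 j + ∑ i, y.2 i * ((z i.succ).2 j - (z 0).2 j))

theorem subst_proj (D : LeftLinearForm.{u}) {n k : ℕ} (i : Fin k) (z : Fin k → D.Op n) :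
    D.subst (D.proj i) z = z i := by
  match k, n, i, z with
  | 0, _, i, _ => exact i.elim0
  | _ + 1, 0, _, z => exact (z 0).elim
  | k + 1, n + 1, i, z =>
    induction i using Fin.cases with
    | zero =>
      refine Prod.ext ?_ (funext fun j => ?_) <;>
        simp [subst, proj, Fin.succ_ne_zero]
    | succ i =>
      refine Prod.ext ?_ (funext fun j => ?_) <;>
        simp [subst, proj, Fin.succ_inj]

theorem proj_subst (D : LeftLinearForm.{u}) {n : ℕ} (y : D.Op n) :
    D.subst y D.proj = y := by
  match n, y with
  | 0, y => exact y.elim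
  | n + 1, (x, r) =>
    refine Prod.ext ?_ (funext fun j => ?_) <;>
      simp [subst, proj, Fin.succ_inj, Fin.succ_ne_zero]

theorem subst_aux {R N : Type*} [Ring R] [AddCommGroup N] [Module R N] {k l : ℕ} (p : R)
    (r : Fin l → R) (q : R) (q' : Fin l → R) (s : Fin k → R) (s' : Fin l → Fin k → R)
    (t : N) (d : Fin k → N) :
    (1 - (p + (1 - p) * q + ∑ i, r i * (q' i - q))) • t +
        ∑ j, ((1 - p) * s j + ∑ i, r i * (s' i j - s j)) • d j =
      (1 - p) • ((1 - q) • t + ∑ j, s j • d j) +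
        ∑ i, r i • (((1 - q' i) • t + ∑ j, s' i j • d j) - ((1 - q) • t + ∑ j, s j • d j)) := by
  have h1 : ∀ i, r i • (((1 - q' i) • t + ∑ j, s' i j • d j) - ((1 - q) • t + ∑ j, s j • d j)) =
      ∑ j, (r i * (s' i j - s j)) • d j - (r i * (q' i - q)) • t := by
    intro i
    simp only [mul_smul, ← Finset.smul_sum, sub_smul, Finset.sum_sub_distrib, smul_sub, smul_add]
    abel
  simp only [h1, Finset.sum_sub_distrib, add_smul, Finset.sum_add_distrib, Finset.sum_smul]
  rw [Finset.sum_comm]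
  simp only [sub_smul, add_smul, one_smul, smul_add, smul_sub, mul_smul, Finset.sum_smul,
    Finset.smul_sum, Finset.sum_sub_distrib]
  abel

theorem subst_subst (D : LeftLinearForm.{u}) {n k l : ℕ} (y : D.Op l) (z : Fin l → D.Op k)
    (t : Fin k → D.Op n) :
    D.subst (D.subst y z) t = D.subst y (fun i => D.subst (z i) t) := by
  match l, k, n, y, z, t with
  | 0, _, _, y, _, _ => exact y.elim
  | _ + 1, 0, _, _, z, _ => exact (z 0).elim
  | _ + 1, _ + 1, 0, _, _, t => exact (t 0).elim
  | l + 1, k + 1, n + 1, (x, r), z, t =>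
    refine Prod.ext ?_ (funext fun j => ?_)
    · have := subst_aux (D.form x) r (D.form (z 0).1) (fun i => D.form (z i.succ).1) (z 0).2
        (fun i => (z i.succ).2) (t 0).1 (fun j => (t j.succ).1 - (t 0).1)
      simp only [subst, map_add, map_sum, map_smul, map_sub, smul_eq_mul]
      rw [add_assoc, this]
      simp only [smul_add, smul_sub, Finset.sum_add_distrib, Finset.sum_sub_distrib]
      abel
    · have := subst_aux (D.form x) r (D.form (z 0).1) (fun i => D.form (z i.succ).1) (z 0).2
        (fun i => (z i.succ).2) ((t 0).2 j) (fun i => (t i.succ).2 j - (t 0).2 j)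
      simp only [smul_eq_mul] at this
      simp only [subst, map_add, map_sum, map_smul, map_sub, smul_eq_mul]
      exact this

/-- The theory `T_∂`. -/
def theory (D : LeftLinearForm.{u}) : AlgTheory.{u} where
  Hom n k := Fin k → D.Op n
  id _ := D.proj
  comp f g := fun i => D.subst (g i) f
  id_comp f := funext fun i => D.proj_subst (f i)
  comp_id f := funext fun i => D.subst_proj i f
  assoc f g h := funext fun i => (D.subst_subst (h i) g f).symm
  str f := fun i => D.proj (f i)
  str_id _ := rfl
  str_comp f g := funext fun i => D.subst_proj (g i) _
  isProduct n k := by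
    constructor
    · intro f g h
      funext i
      have := congrFun (congrFun h i) 0
      simpa only [subst_proj] using this
    · intro h
      refine ⟨fun i => h i 0, ?_⟩
      funext i j
      rw [Subsingleton.elim j 0]
      simp only [subst_proj]

/-- An `n`-ary operation of `T_∂` (morphisms `X^n ⟶ X^k` are `k`-tuples of them). -/
def toOperation (D : LeftLinearForm.{u}) {n : ℕ} (y : D.Op n) : D.theory.Operation n := fun _ => y

/-- The action `⟨x, r₁, r₂, …⟩ ↦ ⟨g x, f r₁, f r₂, …⟩` of a morphism on operations. -/
def Morphism.mapOp {D E : LeftLinearForm.{u}} (F : Morphism D E) : {n : ℕ} → D.Op n → E.Op n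
  | 0, y => y.elim
  | _ + 1, y => (F.g y.1, fun j => F.f (y.2 j))

theorem Morphism.mapOp_proj {D E : LeftLinearForm.{u}} (F : Morphism D E) {n : ℕ} (i : Fin n) :
    F.mapOp (D.proj i) = E.proj i := by
  match n, i with
  | 0, i => exact i.elim0
  | n + 1, i =>
    refine Prod.ext ?_ (funext fun j => ?_)
    · simp [mapOp, proj]
    · simp [mapOp, proj, apply_ite F.f]

theorem Morphism.mapOp_subst {D E : LeftLinearForm.{u}} (F : Morphism D E) {k n : ℕ}
    (y : D.Op k) (z : Fin k → D.Op n) :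
    F.mapOp (D.subst y z) = E.subst (F.mapOp y) (fun i => F.mapOp (z i)) := by
  match k, n, y, z with
  | 0, _, y, _ => exact y.elim
  | _ + 1, 0, _, z => exact (z 0).elim
  | k + 1, n + 1, (x, r), z =>
    refine Prod.ext ?_ (funext fun j => ?_)
    · simp [mapOp, subst, F.map_smul, F.comm]
    · simp [mapOp, subst, F.comm]

/-- The functor `∂ ↦ T_∂` from left linear forms to theories. -/
def theoryFunctor : LeftLinearForm.{u} ⥤ AlgTheory.{u} where
  obj D := D.theory
  map {D E} F :=
    { map := fun f i => Morphism.mapOp F (f i)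
      map_id := fun n => funext fun i => Morphism.mapOp_proj F i
      map_comp := fun f g => funext fun i => Morphism.mapOp_subst F (g i) f
      map_str := fun f => funext fun i => Morphism.mapOp_proj F (f i) }
  map_id D := by
    apply AlgTheory.Morphism.ext
    funext n k f i
    match n, f with
    | 0, f => exact (f i).elim
    | n + 1, f => rfl
  map_comp F G := by
    apply AlgTheory.Morphism.ext
    funext n k f i
    match n, f with
    | 0, f => exact (f i).elim
    | n + 1, f => rfl

end LeftLinearForm

/-! ## Affinities -/

/-- The structure of an affinity over the linear form `∂ : M → R` on the set `A`.
Here `add a b c` is `b +_a c`, `smul r a b` is `r_a b`, and `phi x a` is `φ_a(x)`;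
`b -_a c` stands for `b +_a ((-1)_a c)`. -/
structure Affinity (D : LeftLinearForm.{u}) (A : Type v) where
  add : A → A → A → A
  smul : D.R → A → A → A
  phi : D.M → A → A
  -- `m(x,y,z) = x +_y z` makes `A` an abelian herd.
  maltsev_left : ∀ x y, add y x y = x
  maltsev_right : ∀ x y, add y y x = x
  herd_assoc : ∀ t s x y z, add s t (add y x z) = add y (add s t x) z
  herd_comm : ∀ x y z, add y x z = add y z x
  -- Each `a` makes `A` a module with zero `a`, and `φ_a` a module homomorphism.
  add_assoc : ∀ a b c d, add a b (add a c d) = add a (add a b c) d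
  zero_add : ∀ a b, add a a b = b
  add_comm : ∀ a b c, add a b c = add a c b
  sub_self : ∀ a b, add a b (smul (-1) a b) = a
  smul_add : ∀ r a b c, smul r a (add a b c) = add a (smul r a b) (smul r a c)
  add_smul : ∀ r s a b, smul (r + s) a b = add a (smul r a b) (smul s a b)
  one_smul : ∀ a b, smul 1 a b = b
  mul_smul : ∀ r s a b, smul r a (smul s a b) = smul (r * s) a b
  phi_add : ∀ x y a, phi (x + y) a = add a (phi x a) (phi y a)
  phi_smul : ∀ (r : D.R) (x : D.M) a, phi (r • x) a = smul r a (phi x a)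
  -- Coordinate change from the base point `a` to the base point `a'`.
  add_change : ∀ a a' b c, add a' b c =
    add a (add a (add a b (smul (-1) a a')) (add a c (smul (-1) a a'))) a'
  smul_change : ∀ r a a' b, smul r a' b = add a (smul r a (add a b (smul (-1) a a'))) a'
  phi_change : ∀ x a a', phi x a' = add a (phi x a) (smul (1 - D.form x) a a')

namespace Affinity

/-- Homomorphisms of affinities. -/
def IsHom {D : LeftLinearForm.{u}} {A : Type v} {B : Type w} (P : Affinity D A) (Q : Affinity D B)
    (h : A → B) : Prop :=
  (∀ a b c, h (P.add b a c) = Q.add (h b) (h a) (h c)) ∧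
  (∀ r a b, h (P.smul r a b) = Q.smul r (h a) (h b)) ∧
  (∀ x a, h (P.phi x a) = Q.phi x (h a))

/-- An affinity and a model of `T_∂` with the same underlying set correspond to each other:
`b +_a c`, `r_a b` and `φ_a(x)` are the operations `⟨0, 1, 1⟩(a, b, c)`, `⟨0, r⟩(a, b)` and
`⟨x⟩(a)`. -/
def Corresponds {D : LeftLinearForm.{u}} {A : Type v} (P : Affinity D A)
    (S : D.theory.Model A) : Prop :=
  (∀ a b c, P.add a b c = S.op (D.toOperation (n := 3) ((0 : D.M), ![1, 1])) ![a, b, c]) ∧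
  (∀ r a b, P.smul r a b = S.op (D.toOperation (n := 2) ((0 : D.M), ![r])) ![a, b]) ∧
  (∀ x a, P.phi x a = S.op (D.toOperation (n := 1) (x, ![])) ![a])

end Affinity

/-! In an affinity every point `a` turns the set into an `R`-module with zero `a`, and the
change-of-base formulas express all operations at any other point inside this one module. The
operation `⟨x, r₁, r₂, …⟩` has the value `φ(x) + ∑ rᵢ bᵢ`, computed in the module based at the first
argument `b₀`. Rewritten at an arbitrary base point (`Affinity.toAt_eval`), it becomes the affine
formula from which the composition law comes. Hence evaluation respects composition and an affinity
is a model.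

Conversely, the operations of positive arity `n` form the module `M × R^{n-1}`, which contains `M`
and is therefore an affinity. Its identities, applied to projections, hold in every model of `T_∂`.
Every operation is a sum of operations `⟨x⟩` and `⟨0, r⟩`, so the affinity determines the model.
Such a model is abelian because `b - a = d - c` is a congruence on `A × A` that relates all diagonal
pairs and separates pairs with equal first entry.

For the equivalence, a morphism `T_∂ ⟶ T_∂'` must preserve `⟨0, 1, 1⟩`, which is determined by its
Maltsev identities, and sends each `⟨0, r⟩` to some `⟨0, r'⟩`, by idempotence. So it respects the
affinity structure and comes from a morphism of forms.

For essential surjectivity, the commutator condition forces a Maltsev operation `p` to commute with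
every operation (`Model.IsAbelian.op_comm`), so `p` is an abelian herd operation and all operations
are affine for it. Then `R` consists of the idempotent binary operations, `M` of the unary ones, and
`∂x` is `(a, b) ↦ b - x(b) + x(a)`. Every model is an affinity over this form. Without nullary
operations, an operation is recovered from its value on a constant tuple and its increments in the
single variables (`interpret_injective`, `interpret_surjective`). -/

namespace AlgTheory.Model

variable {T : AlgTheory.{u}} {A : Type v} (S : T.Model A)

theorem op_comp {n k : ℕ} (f : T.Hom n k) (g : T.Operation k) (a : Fin n → A) :
    S.op (T.comp f g) a = S.op g (S.act f a) := by
  simp only [op, S.act_comp]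

theorem op_str {n : ℕ} (f : Fin 1 → Fin n) (a : Fin n → A) : S.op (T.str f) a = a (f 0) := by
  simp only [op, S.act_str]

theorem act_apply {n k : ℕ} (f : T.Hom n k) (a : Fin n → A) (i : Fin k) :
    S.act f a i = S.op (T.comp f (T.str fun _ : Fin 1 => i)) a := by
  rw [op_comp, op_str]

/-- Each `X^k` is a power of `X`, so the components of the action are themselves operations. -/
theorem ext_op {S S' : T.Model A}
    (h : ∀ (n : ℕ) (f : T.Operation n) (a : Fin n → A), S.op f a = S'.op f a) : S = S' := by
  have : @act _ _ S = @act _ _ S' := by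
    funext n k f a i
    rw [act_apply, act_apply, h]
  cases S
  cases S'
  simpa using this

end AlgTheory.Model

/-! ### Components of the operations of `T_∂` -/

namespace LeftLinearForm

variable {D : LeftLinearForm.{u}}

namespace Op

/-- The operation `⟨x, r₁, r₂, …⟩`. -/
def mk {n : ℕ} (x : D.M) (r : Fin n → D.R) : D.Op (n + 1) := (x, r)

/-- The component `x` of the operation `⟨x, r₁, r₂, …⟩`. -/
def const {n : ℕ} (y : D.Op (n + 1)) : D.M := y.1

/-- The components `r₁, r₂, …` of the operation `⟨x, r₁, r₂, …⟩`. -/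
def coeff {n : ℕ} (y : D.Op (n + 1)) : Fin n → D.R := y.2

@[simp] theorem const_mk {n : ℕ} (x : D.M) (r : Fin n → D.R) : (mk x r).const = x := rfl

@[simp] theorem coeff_mk {n : ℕ} (x : D.M) (r : Fin n → D.R) : (mk x r).coeff = r := rfl

theorem ext {n : ℕ} {y z : D.Op (n + 1)} (h : y.const = z.const)
    (h' : ∀ j, y.coeff j = z.coeff j) : y = z := Prod.ext h (funext h')

@[simp] theorem const_proj {n : ℕ} (i : Fin (n + 1)) : (D.proj i).const = 0 := rfl

theorem coeff_proj {n : ℕ} (i : Fin (n + 1)) (j : Fin n) :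
    (D.proj i).coeff j = if j.succ = i then 1 else 0 := rfl

@[simp] theorem coeff_proj_zero {n : ℕ} (j : Fin n) : (D.proj 0).coeff j = 0 := by
  simp [coeff_proj, Fin.succ_ne_zero]

@[simp] theorem coeff_proj_succ {n : ℕ} (i j : Fin n) :
    (D.proj i.succ).coeff j = if j = i then 1 else 0 := by
  simp [coeff_proj, Fin.succ_inj]

theorem const_subst {k n : ℕ} (y : D.Op (k + 1)) (z : Fin (k + 1) → D.Op (n + 1)) :
    (D.subst y z).const = y.const + (1 - D.form y.const) • (z 0).const +
      ∑ i, y.coeff i • ((z i.succ).const - (z 0).const) := rfl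

theorem coeff_subst {k n : ℕ} (y : D.Op (k + 1)) (z : Fin (k + 1) → D.Op (n + 1)) (j : Fin n) :
    (D.subst y z).coeff j = (1 - D.form y.const) * (z 0).coeff j +
      ∑ i, y.coeff i * ((z i.succ).coeff j - (z 0).coeff j) := rfl

end Op

end LeftLinearForm

/-! ### From affinities to models -/

namespace Affinity

open LeftLinearForm

variable {D : LeftLinearForm.{u}}

theorem ext_operations {A : Type v} {P Q : Affinity D A} (h₁ : P.add = Q.add)
    (h₂ : P.smul = Q.smul) (h₃ : P.phi = Q.phi) : P = Q := by
  cases P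
  cases Q
  cases h₁
  cases h₂
  cases h₃
  rfl

/-- A module `N` over `R` with a homomorphism `M → N` is an affinity. -/
def ofModule {N : Type v} [AddCommGroup N] [Module D.R N] (ι : D.M →ₗ[D.R] N) :
    Affinity D N where
  add a b c := b - a + c
  smul r a b := a + r • (b - a)
  phi x a := ι x + (1 - D.form x) • a
  maltsev_left x y := by abel
  maltsev_right x y := by abel
  herd_assoc t s x y z := by abel
  herd_comm x y z := by abel
  add_assoc a b c d := by abel
  zero_add a b := by abel
  add_comm a b c := by abel
  sub_self a b := by simp only [neg_smul, _root_.one_smul]; abel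
  smul_add r a b c := by simp only [smul_sub, _root_.smul_add]; abel
  add_smul r s a b := by simp only [_root_.add_smul]; abel
  one_smul a b := by simp
  mul_smul r s a b := by simp [SemigroupAction.mul_smul]
  phi_add x y a := by simp only [map_add, sub_smul, _root_.add_smul, _root_.one_smul]; abel
  phi_smul r x a := by
    simp only [map_smul, sub_smul, SemigroupAction.mul_smul, smul_eq_mul, smul_sub, _root_.smul_add,
      _root_.one_smul]
    abel
  add_change a a' b c := by simp only [neg_smul, _root_.one_smul]; abel
  smul_change r a a' b := by
    simp only [neg_smul, _root_.one_smul, smul_sub, _root_.smul_add, smul_neg]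
    abel
  phi_change x a a' := by simp only [sub_smul, smul_sub, _root_.one_smul]; abel

/-! ### The module with a given base point -/

variable {A : Type v} (P : Affinity D A)

theorem smul_base (r : D.R) (a : A) : P.smul r a a = a := by
  have h := P.smul_add r a a a
  rw [P.zero_add] at h
  -- From `r a = r a + r a`, in the group with zero `a`, cancel `r a` by adding its negative; the
  -- group instance is not yet available.
  have h' := congrArg (fun y => P.add a y (P.smul (-1) a (P.smul r a a))) h
  simp only [P.sub_self, ← P.add_assoc] at h'
  rw [P.add_comm, P.zero_add] at h'
  exact h'.symm

theorem zero_smul (a b : A) : P.smul 0 a b = a := by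
  have h := P.add_smul 1 (-1) a b
  rw [P.one_smul, P.sub_self] at h
  simpa using h

/-- The set underlying an affinity, with `a` regarded as base point. -/
def At (_ : Affinity D A) (_ : A) : Type v := A

instance (a : A) : Zero (P.At a) := ⟨a⟩

instance (a : A) : Add (P.At a) := ⟨P.add a⟩

instance (a : A) : Neg (P.At a) := ⟨P.smul (-1) a⟩

instance (a : A) : AddCommGroup (P.At a) where
  add_assoc b c d := (P.add_assoc a b c d).symm
  zero_add := P.zero_add a
  add_zero b := (P.add_comm a b a).trans (P.zero_add a b)
  add_comm := P.add_comm a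
  neg_add_cancel b := (P.add_comm a _ b).trans (P.sub_self a b)
  nsmul := nsmulRec
  zsmul := zsmulRec

instance (a : A) : Module D.R (P.At a) where
  smul r b := P.smul r a b
  one_smul := P.one_smul a
  mul_smul r s b := (P.mul_smul r s a b).symm
  smul_zero r := P.smul_base r a
  smul_add r := P.smul_add r a
  add_smul r s := P.add_smul r s a
  zero_smul := P.zero_smul a

/-- The map `φ_a : M → A`. -/
def phiLinear (a : A) : D.M →ₗ[D.R] P.At a where
  toFun x := P.phi x a
  map_add' x y := P.phi_add x y a
  map_smul' r x := P.phi_smul r x a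

/-- An element, regarded as an element of the module with base point `a`. -/
def toAt (a b : A) : P.At a := b

theorem toAt_injective (a : A) {b c : A} (h : P.toAt a b = P.toAt a c) : b = c := h

/-- With `toAt_smul` and `toAt_phi`, this moves operations at any base point `a'` into the single
module at `a`, where identities become linear algebra. -/
theorem toAt_add (a a' b c : A) :
    P.toAt a (P.add a' b c) = P.toAt a b - P.toAt a a' + P.toAt a c := by
  have h : P.toAt a (P.add a' b c) =
      (P.toAt a b + (-1 : D.R) • P.toAt a a') + (P.toAt a c + (-1 : D.R) • P.toAt a a') +
        P.toAt a a' := P.add_change a a' b c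
  rw [h, neg_smul, _root_.one_smul]
  abel

theorem toAt_smul (r : D.R) (a a' b : A) :
    P.toAt a (P.smul r a' b) = P.toAt a a' + r • (P.toAt a b - P.toAt a a') := by
  have h : P.toAt a (P.smul r a' b) =
      r • (P.toAt a b + (-1 : D.R) • P.toAt a a') + P.toAt a a' := P.smul_change r a a' b
  rw [h, neg_smul, _root_.one_smul, ← sub_eq_add_neg, _root_.add_comm]

theorem toAt_phi (x : D.M) (a a' : A) :
    P.toAt a (P.phi x a') = P.phiLinear a x + (1 - D.form x) • P.toAt a a' :=
  P.phi_change x a a'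

theorem toAt_self (a : A) : P.toAt a a = 0 := rfl

/-- Translation from the base point `a'` to the base point `a`. -/
def translate (a a' : A) : P.At a' →+ P.At a where
  toFun b := P.toAt a b - P.toAt a a'
  map_zero' := _root_.sub_self _
  map_add' b c := by
    have := P.toAt_add a a' b c
    change P.toAt a (P.add a' b c) - _ = _
    rw [this]
    abel

/-- The value of the operation `⟨x, r₁, r₂, …⟩` in an affinity. -/
def eval : {n : ℕ} → D.Op n → (Fin n → A) → A
  | 0, y, _ => y.elim
  | _ + 1, y, b => (P.phiLinear (b 0) (Op.const y) +
      ∑ i, Op.coeff y i • P.toAt (b 0) (b i.succ) : P.At (b 0))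

/-- `eval` uses the module at `b 0`, which varies with the arguments. Translation to the module at
`a` is additive, so each summand can be moved separately by the change-of-base formulas. -/
theorem toAt_eval {n : ℕ} (a : A) (y : D.Op (n + 1)) (b : Fin (n + 1) → A) :
    P.toAt a (P.eval y b) = P.phiLinear a y.const + (1 - D.form y.const) • P.toAt a (b 0) +
      ∑ i, y.coeff i • (P.toAt a (b i.succ) - P.toAt a (b 0)) := by
  have h : P.toAt a (P.eval y b) = P.translate a (b 0) (P.phiLinear (b 0) y.const +
      ∑ i, y.coeff i • P.toAt (b 0) (b i.succ)) + P.toAt a (b 0) := by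
    change P.toAt a _ = P.toAt a _ - _ + _
    rw [sub_add_cancel]
    rfl
  have h₁ : P.translate a (b 0) (P.phiLinear (b 0) y.const) =
      P.toAt a (P.phi y.const (b 0)) - P.toAt a (b 0) := rfl
  have h₂ (i) : P.translate a (b 0) (y.coeff i • P.toAt (b 0) (b i.succ)) =
      P.toAt a (P.smul (y.coeff i) (b 0) (b i.succ)) - P.toAt a (b 0) := rfl
  rw [h, map_add, map_sum, h₁, toAt_phi]
  simp only [h₂, toAt_smul, add_sub_cancel_left]
  abel

theorem eval_subst {k n : ℕ} (y : D.Op k) (z : Fin k → D.Op n) (t : Fin n → A) :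
    P.eval (D.subst y z) t = P.eval y (fun i => P.eval (z i) t) := by
  match k, n, y, z, t with
  | 0, _, y, _, _ => exact y.elim
  | _ + 1, 0, _, z, _ => exact (z 0).elim
  | k + 1, n + 1, y, z, t =>
    -- At the base point `t 0` all terms in `t 0` vanish, and the two sides differ only in the order
    -- of a double sum.
    refine P.toAt_injective (t 0) ?_
    simp only [toAt_eval, toAt_self, smul_zero, add_zero, sub_zero]
    simp only [Op.const_subst, Op.coeff_subst, map_add, map_sum, map_smul, map_sub, _root_.add_smul,
      Finset.sum_add_distrib, Finset.sum_smul, SemigroupAction.mul_smul, _root_.smul_add, smul_sub,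
      Finset.smul_sum, sub_smul, Finset.sum_sub_distrib]
    rw [Finset.sum_comm, Finset.sum_comm (s := Finset.univ (α := Fin n))]
    abel

theorem eval_proj {n : ℕ} (i : Fin n) (t : Fin n → A) : P.eval (D.proj i) t = t i := by
  match n, i with
  | 0, i => exact i.elim0
  | n + 1, i =>
    refine P.toAt_injective (t 0) ?_
    rw [toAt_eval]
    induction i using Fin.cases with
    | zero => simp [ toAt_self]
    | succ i => simp [ toAt_self]

/-- The model of `T_∂` given by an affinity over `∂`. -/
def toModel : D.theory.Model A where
  act f a i := P.eval (f i) a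
  act_id _ a := funext fun i => P.eval_proj i a
  act_comp f g a := funext fun i => P.eval_subst (g i) f a
  act_str f a := funext fun i => P.eval_proj (f i) a

theorem toModel_op {n : ℕ} (y : D.Op n) (a : Fin n → A) :
    P.toModel.op (D.toOperation y) a = P.eval y a := rfl

theorem corresponds_toModel : P.Corresponds P.toModel := by
  refine ⟨fun a b c => ?_, fun r a b => ?_, fun x a => ?_⟩
  · change _ = P.eval (Op.mk 0 ![1, 1]) _
    refine P.toAt_injective a ?_
    simp [toAt_eval, toAt_add, toAt_self, Fin.sum_univ_succ]
  · change _ = P.eval (Op.mk 0 ![r]) _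
    refine P.toAt_injective a ?_
    simp [toAt_eval, toAt_smul, toAt_self]
  · change _ = P.eval (Op.mk x ![]) _
    refine P.toAt_injective a ?_
    simp [toAt_eval, toAt_phi, toAt_self]

end Affinity

/-! ### From models to affinities -/

namespace LeftLinearForm

variable {D : LeftLinearForm.{u}}

namespace Op

instance {n : ℕ} : AddCommGroup (D.Op (n + 1)) :=
  inferInstanceAs (AddCommGroup (D.M × (Fin n → D.R)))

instance {n : ℕ} : Module D.R (D.Op (n + 1)) :=
  inferInstanceAs (Module D.R (D.M × (Fin n → D.R)))

/-- The component `x` of `⟨x, r₁, r₂, …⟩` as a linear map. -/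
def constHom (D : LeftLinearForm.{u}) (n : ℕ) : D.Op (n + 1) →ₗ[D.R] D.M where
  toFun := const
  map_add' _ _ := rfl
  map_smul' _ _ := rfl

/-- The component `r_j` of `⟨x, r₁, r₂, …⟩` as a linear map. -/
def coeffHom (D : LeftLinearForm.{u}) {n : ℕ} (j : Fin n) : D.Op (n + 1) →ₗ[D.R] D.R where
  toFun y := coeff y j
  map_add' _ _ := rfl
  map_smul' _ _ := rfl

@[simp] theorem const_add {n : ℕ} (y z : D.Op (n + 1)) : (y + z).const = y.const + z.const := rfl
@[simp] theorem const_sub {n : ℕ} (y z : D.Op (n + 1)) : (y - z).const = y.const - z.const := rfl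
@[simp] theorem const_smul {n : ℕ} (r : D.R) (y : D.Op (n + 1)) :
    (r • y).const = r • y.const := rfl
@[simp] theorem const_sum {n : ℕ} {ι : Type*} (s : Finset ι) (y : ι → D.Op (n + 1)) :
    (∑ i ∈ s, y i).const = ∑ i ∈ s, (y i).const := map_sum (constHom D n) y s
@[simp] theorem coeff_add {n : ℕ} (y z : D.Op (n + 1)) (j : Fin n) :
    (y + z).coeff j = y.coeff j + z.coeff j := rfl
@[simp] theorem coeff_sub {n : ℕ} (y z : D.Op (n + 1)) (j : Fin n) :
    (y - z).coeff j = y.coeff j - z.coeff j := rfl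
@[simp] theorem coeff_smul {n : ℕ} (r : D.R) (y : D.Op (n + 1)) (j : Fin n) :
    (r • y).coeff j = r * y.coeff j := rfl
@[simp] theorem coeff_sum {n : ℕ} {ι : Type*} (s : Finset ι) (y : ι → D.Op (n + 1))
    (j : Fin n) : (∑ i ∈ s, y i).coeff j = ∑ i ∈ s, (y i).coeff j :=
  map_sum (coeffHom D j) y s

/-- The inclusion `x ↦ ⟨x, 0, 0, …⟩`. -/
def inclusion (D : LeftLinearForm.{u}) (n : ℕ) : D.M →ₗ[D.R] D.Op (n + 1) where
  toFun x := mk x 0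
  map_add' _ _ := Op.ext rfl fun _ => (add_zero (0 : D.R)).symm
  map_smul' r _ := Op.ext rfl fun _ => (mul_zero r).symm

theorem inclusion_apply {n : ℕ} (x : D.M) : inclusion D n x = mk x 0 := rfl

/-- The composition law is an affine formula in the module of operations, so substitution into `⟨0,
1, 1⟩`, `⟨0, r⟩` and `⟨x⟩` gives the operations of `ofModule`. -/
theorem subst_eq {k n : ℕ} (y : D.Op (k + 1)) (z : Fin (k + 1) → D.Op (n + 1)) :
    D.subst y z = inclusion D n y.const + (1 - D.form y.const) • z 0 +
      ∑ i, y.coeff i • (z i.succ - z 0) := by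
  refine Op.ext ?_ fun j => ?_
  · simp [const_subst, inclusion_apply]
  · simp [coeff_subst, inclusion_apply]

end Op

/-- The affinity of `n + 1`-ary operations. -/
def freeAffinity (D : LeftLinearForm.{u}) (n : ℕ) : Affinity D (D.Op (n + 1)) :=
  Affinity.ofModule (Op.inclusion D n)

theorem subst_add {n : ℕ} (a b c : D.Op (n + 1)) :
    D.subst (Op.mk 0 ![1, 1]) ![a, b, c] = (D.freeAffinity n).add a b c := by
  rw [Op.subst_eq]
  simp [freeAffinity, Affinity.ofModule, Fin.sum_univ_succ]
  abel

theorem subst_smul {n : ℕ} (r : D.R) (a b : D.Op (n + 1)) :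
    D.subst (Op.mk 0 ![r]) ![a, b] = (D.freeAffinity n).smul r a b := by
  rw [Op.subst_eq]
  simp [freeAffinity, Affinity.ofModule]

theorem subst_phi {n : ℕ} (x : D.M) (a : D.Op (n + 1)) :
    D.subst (Op.mk x ![]) ![a] = (D.freeAffinity n).phi x a := by
  rw [Op.subst_eq]
  simp [freeAffinity, Affinity.ofModule]

section Model

variable {A : Type v} (S : D.theory.Model A)

theorem op_subst {k n : ℕ} (y : D.Op k) (z : Fin k → D.Op n) (t : Fin n → A) :
    S.op (D.toOperation (D.subst y z)) t =
      S.op (D.toOperation y) (fun i => S.op (D.toOperation (z i)) t) := by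
  have h : D.toOperation (D.subst y z) = D.theory.comp z (D.toOperation y) := rfl
  refine (congrArg (fun f => S.op f t) h).trans ((S.op_comp _ _ t).trans ?_)
  congr 1
  funext i
  refine (S.act_apply _ t i).trans (congrArg (fun f => S.op f t) ?_)
  funext j
  exact D.subst_proj i z

theorem op_proj {n : ℕ} (i : Fin n) (t : Fin n → A) :
    S.op (D.toOperation (D.proj i)) t = t i :=
  S.op_str (fun _ => i) t

/-- The operation `b +_a c` of a model. -/
def modelAdd (a b c : A) : A := S.op (D.toOperation (Op.mk 0 ![1, 1])) ![a, b, c]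

/-- The operation `r_a b` of a model. -/
def modelSmul (r : D.R) (a b : A) : A := S.op (D.toOperation (Op.mk 0 ![r])) ![a, b]

/-- The operation `φ_a(x)` of a model. -/
def modelPhi (x : D.M) (a : A) : A := S.op (D.toOperation (Op.mk x ![])) ![a]

/-- The evaluation of operations at a tuple of elements of a model. -/
def evalAt {n : ℕ} (t : Fin n → A) (y : D.Op n) : A := S.op (D.toOperation y) t

theorem modelAdd_evalAt {n : ℕ} (t : Fin (n + 1) → A) (a b c : D.Op (n + 1)) :
    modelAdd S (evalAt S t a) (evalAt S t b) (evalAt S t c) =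
      evalAt S t ((D.freeAffinity n).add a b c) := by
  rw [← subst_add]
  refine Eq.trans ?_ (op_subst S _ _ t).symm
  rw [modelAdd]
  congr 1
  funext i
  fin_cases i <;> rfl

theorem modelSmul_evalAt {n : ℕ} (t : Fin (n + 1) → A) (r : D.R) (a b : D.Op (n + 1)) :
    modelSmul S r (evalAt S t a) (evalAt S t b) =
      evalAt S t ((D.freeAffinity n).smul r a b) := by
  rw [← subst_smul]
  refine Eq.trans ?_ (op_subst S _ _ t).symm
  rw [modelSmul]
  congr 1
  funext i
  fin_cases i <;> rfl

theorem modelPhi_evalAt {n : ℕ} (t : Fin (n + 1) → A) (x : D.M) (a : D.Op (n + 1)) :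
    modelPhi S x (evalAt S t a) = evalAt S t ((D.freeAffinity n).phi x a) := by
  rw [← subst_phi]
  refine Eq.trans ?_ (op_subst S _ _ t).symm
  rw [modelPhi]
  congr 1
  funext i
  fin_cases i
  rfl

/-- Any elements are values of projections, so an identity valid in `D.freeAffinity 4` passes to
every model. Five variables are needed for `herd_assoc`, the longest axiom. -/
theorem exists_evalAt (a b c d e : A) : ∃ (t : Fin 5 → A) (a' b' c' d' e' : D.Op 5),
    evalAt S t a' = a ∧ evalAt S t b' = b ∧ evalAt S t c' = c ∧ evalAt S t d' = d ∧
      evalAt S t e' = e :=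
  ⟨![a, b, c, d, e], D.proj 0, D.proj 1, D.proj 2, D.proj 3, D.proj 4, op_proj S _ _,
    op_proj S _ _, op_proj S _ _, op_proj S _ _, op_proj S _ _⟩

/-- The affinity given by a model of `T_∂`. -/
def toAffinity : Affinity D A where
  add := modelAdd S
  smul := modelSmul S
  phi := modelPhi S
  maltsev_left x y := by
    obtain ⟨t, x, y, -, -, -, rfl, rfl, -⟩ := exists_evalAt S x y y y y
    simp only [modelAdd_evalAt]
    exact congrArg _ ((D.freeAffinity 4).maltsev_left x y)
  maltsev_right x y := by
    obtain ⟨t, x, y, -, -, -, rfl, rfl, -⟩ := exists_evalAt S x y y y y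
    simp only [modelAdd_evalAt]
    exact congrArg _ ((D.freeAffinity 4).maltsev_right x y)
  herd_assoc t s x y z := by
    obtain ⟨_, t, s, x, y, z, rfl, rfl, rfl, rfl, rfl⟩ := exists_evalAt S t s x y z
    simp only [modelAdd_evalAt]
    exact congrArg _ ((D.freeAffinity 4).herd_assoc t s x y z)
  herd_comm x y z := by
    obtain ⟨_, x, y, z, -, -, rfl, rfl, rfl, -⟩ := exists_evalAt S x y z z z
    simp only [modelAdd_evalAt]
    exact congrArg _ ((D.freeAffinity 4).herd_comm x y z)
  add_assoc a b c d := by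
    obtain ⟨_, a, b, c, d, -, rfl, rfl, rfl, rfl, -⟩ := exists_evalAt S a b c d d
    simp only [modelAdd_evalAt]
    exact congrArg _ ((D.freeAffinity 4).add_assoc a b c d)
  zero_add a b := by
    obtain ⟨_, a, b, -, -, -, rfl, rfl, -⟩ := exists_evalAt S a b b b b
    simp only [modelAdd_evalAt]
    exact congrArg _ ((D.freeAffinity 4).zero_add a b)
  add_comm a b c := by
    obtain ⟨_, a, b, c, -, -, rfl, rfl, rfl, -⟩ := exists_evalAt S a b c c c
    simp only [modelAdd_evalAt]
    exact congrArg _ ((D.freeAffinity 4).add_comm a b c)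
  sub_self a b := by
    obtain ⟨_, a, b, -, -, -, rfl, rfl, -⟩ := exists_evalAt S a b b b b
    simp only [modelAdd_evalAt, modelSmul_evalAt]
    exact congrArg _ ((D.freeAffinity 4).sub_self a b)
  smul_add r a b c := by
    obtain ⟨_, a, b, c, -, -, rfl, rfl, rfl, -⟩ := exists_evalAt S a b c c c
    simp only [modelAdd_evalAt, modelSmul_evalAt]
    exact congrArg _ ((D.freeAffinity 4).smul_add r a b c)
  add_smul r s a b := by
    obtain ⟨_, a, b, -, -, -, rfl, rfl, -⟩ := exists_evalAt S a b b b b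
    simp only [modelAdd_evalAt, modelSmul_evalAt]
    exact congrArg _ ((D.freeAffinity 4).add_smul r s a b)
  one_smul a b := by
    obtain ⟨_, a, b, -, -, -, rfl, rfl, -⟩ := exists_evalAt S a b b b b
    simp only [modelSmul_evalAt]
    exact congrArg _ ((D.freeAffinity 4).one_smul a b)
  mul_smul r s a b := by
    obtain ⟨_, a, b, -, -, -, rfl, rfl, -⟩ := exists_evalAt S a b b b b
    simp only [modelSmul_evalAt]
    exact congrArg _ ((D.freeAffinity 4).mul_smul r s a b)
  phi_add x y a := by
    obtain ⟨_, a, -, -, -, -, rfl, -⟩ := exists_evalAt S a a a a a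
    simp only [modelAdd_evalAt, modelPhi_evalAt]
    exact congrArg _ ((D.freeAffinity 4).phi_add x y a)
  phi_smul r x a := by
    obtain ⟨_, a, -, -, -, -, rfl, -⟩ := exists_evalAt S a a a a a
    simp only [modelSmul_evalAt, modelPhi_evalAt]
    exact congrArg _ ((D.freeAffinity 4).phi_smul r x a)
  add_change a a' b c := by
    obtain ⟨_, a, a', b, c, -, rfl, rfl, rfl, rfl, -⟩ := exists_evalAt S a a' b c c
    simp only [modelAdd_evalAt, modelSmul_evalAt]
    exact congrArg _ ((D.freeAffinity 4).add_change a a' b c)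
  smul_change r a a' b := by
    obtain ⟨_, a, a', b, -, -, rfl, rfl, rfl, -⟩ := exists_evalAt S a a' b b b
    simp only [modelAdd_evalAt, modelSmul_evalAt]
    exact congrArg _ ((D.freeAffinity 4).smul_change r a a' b)
  phi_change x a a' := by
    obtain ⟨_, a, a', -, -, -, rfl, rfl, -⟩ := exists_evalAt S a a' a' a' a'
    simp only [modelAdd_evalAt, modelSmul_evalAt, modelPhi_evalAt]
    exact congrArg _ ((D.freeAffinity 4).phi_change x a a')

theorem corresponds_toAffinity : (toAffinity S).Corresponds S :=
  ⟨fun _ _ _ => rfl, fun _ _ _ => rfl, fun _ _ => rfl⟩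

end Model

end LeftLinearForm

/-! ### Uniqueness of the correspondence, and homomorphisms -/

namespace Affinity

open LeftLinearForm

variable {D : LeftLinearForm.{u}} {A : Type v}

theorem Corresponds.eq_toAffinity {P : Affinity D A} {S : D.theory.Model A}
    (h : P.Corresponds S) : P = toAffinity S :=
  ext_operations (funext fun a => funext fun b => funext fun c => h.1 a b c)
    (funext fun r => funext fun a => funext fun b => h.2.1 r a b)
    (funext fun x => funext fun a => h.2.2 x a)

/-- Evaluation of operations at a tuple is additive. -/
def evalAtHom (S : D.theory.Model A) {n : ℕ} (t : Fin (n + 1) → A) :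
    D.Op (n + 1) →+ (toAffinity S).At (t 0) :=
  AddMonoidHom.mk' (evalAt S t) fun y z => by
    have h := modelAdd_evalAt S t (D.proj 0) y z
    have h₀ : evalAt S t (D.proj 0) = t 0 := op_proj S _ _
    -- The projection `e₀` is the zero of the module of operations, so addition there is addition
    -- with base point `e₀`.
    have h₁ : (D.freeAffinity n).add (D.proj 0) y z = y + z := by
      have h₂ : D.proj (0 : Fin (n + 1)) = 0 := Op.ext rfl fun j => by
        rw [Op.coeff_proj_zero]
        rfl
      simp [h₂, freeAffinity, ofModule]
    rw [h₁, h₀] at h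
    exact h.symm

/-- Since evaluation is additive, this decomposition reduces an arbitrary operation of a model to
the basic ones `φ_a(x)` and `r_a b`. -/
theorem eq_inclusion_add_sum {n : ℕ} (y : D.Op (n + 1)) :
    y = D.subst (Op.mk y.const ![]) ![D.proj 0] +
      ∑ i, D.subst (Op.mk 0 ![y.coeff i]) ![D.proj 0, D.proj i.succ] := by
  refine Op.ext ?_ fun j => ?_
  · simp [Op.const_subst]
  · simp [Op.coeff_subst]

theorem Corresponds.op_eq_eval {P : Affinity D A} {S : D.theory.Model A}
    (h : P.Corresponds S) {n : ℕ} (y : D.Op n) (t : Fin n → A) :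
    S.op (D.toOperation y) t = P.eval y t := by
  obtain rfl := h.eq_toAffinity
  match n, y, t with
  | 0, y, _ => exact y.elim
  | n + 1, y, t =>
    change evalAtHom S t y = (toAffinity S).toAt (t 0) (eval _ y t)
    rw [toAt_eval, toAt_self]
    conv_lhs => rw [eq_inclusion_add_sum y, map_add, map_sum]
    have h₁ : evalAtHom S t (D.subst (Op.mk y.const ![]) ![D.proj 0]) =
        (toAffinity S).phiLinear (t 0) y.const := by
      change S.op (D.toOperation _) t = modelPhi S _ _
      rw [op_subst, modelPhi]
      congr 1
      funext i
      fin_cases i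
      exact op_proj S _ _
    have h₂ (i : Fin n) :
        evalAtHom S t (D.subst (Op.mk 0 ![y.coeff i]) ![D.proj 0, D.proj i.succ]) =
          y.coeff i • (toAffinity S).toAt (t 0) (t i.succ) := by
      change S.op (D.toOperation _) t =
        S.op (D.toOperation (Op.mk 0 ![y.coeff i])) ![t 0, t i.succ]
      rw [op_subst]
      congr 1
      funext j
      fin_cases j
      · exact op_proj S _ _
      · exact op_proj S _ _
    simp only [h₁, h₂, smul_zero, add_zero, sub_zero]

theorem Corresponds.eq_toModel {P : Affinity D A} {S : D.theory.Model A}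
    (h : P.Corresponds S) : S = P.toModel :=
  AlgTheory.Model.ext_op fun n f a => by
    have hf : f = D.toOperation (f 0) := funext fun i => by rw [Subsingleton.elim i 0]; rfl
    rw [hf, h.op_eq_eval, toModel_op]

/-- A homomorphism of affinities is additive from the module at `t 0` to the module at its image,
and the value of an operation is a sum there. -/
theorem IsHom.map_eval {B : Type w} {P : Affinity D A} {Q : Affinity D B} {φ : A → B}
    (h : P.IsHom Q φ) {n : ℕ} (y : D.Op n) (t : Fin n → A) :
    φ (P.eval y t) = Q.eval y (fun i => φ (t i)) := by
  match n, y, t with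
  | 0, y, _ => exact y.elim
  | n + 1, y, t =>
    let ψ : P.At (t 0) →+ Q.At (φ (t 0)) := AddMonoidHom.mk' φ fun b c => h.1 b (t 0) c
    change ψ (P.toAt (t 0) (P.eval y t)) = Q.toAt (φ (t 0)) _
    simp only [toAt_eval, toAt_self, smul_zero, add_zero, sub_zero, map_add, map_sum]
    congr 1
    · exact h.2.2 _ _
    · exact Finset.sum_congr rfl fun i _ => h.2.1 _ _ _

theorem isModelHom_iff_isHom {B : Type w} {P : Affinity D A} {Q : Affinity D B}
    {S : D.theory.Model A} {S' : D.theory.Model B} (h : P.Corresponds S) (h' : Q.Corresponds S')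
    (φ : A → B) : AlgTheory.IsModelHom S S' φ ↔ P.IsHom Q φ := by
  constructor
  · intro hφ
    refine ⟨fun a b c => ?_, fun r a b => ?_, fun x a => ?_⟩
    · rw [h.1, h'.1, hφ]
      congr 1
      funext i
      fin_cases i <;> rfl
    · rw [h.2.1, h'.2.1, hφ]
      congr 1
      funext i
      fin_cases i <;> rfl
    · rw [h.2.2, h'.2.2, hφ]
      congr 1
      funext i
      fin_cases i
      rfl
  · intro hφ n f a
    have hf : f = D.toOperation (f 0) := funext fun i => by rw [Subsingleton.elim i 0]; rfl
    rw [hf, h.op_eq_eval, h'.op_eq_eval, hφ.map_eval]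

end Affinity

/-! ### `T_∂` is abelian and Maltsev -/

namespace AlgTheory

theorem Congruence.commutator_refl {T : AlgTheory.{u}} {A : Type v} {M : T.Model A}
    (R S : Congruence M) (x : A) : R.commutator S x x :=
  ⟨⟨(x, x), R.equivalence.refl x⟩, ⟨(x, x), R.equivalence.refl x⟩,
    fun C _ => C.equivalence.refl _, rfl, rfl, rfl⟩

end AlgTheory

namespace Affinity

open LeftLinearForm AlgTheory

variable {D : LeftLinearForm.{u}} {A : Type v} (P : Affinity D A)

/-- At a fixed base point every operation is a linear map plus a constant. The constants enter with
signs `+`, `-`, `+`, so one copy survives, as on the left. -/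
theorem eval_add {n : ℕ} (y : D.Op n) (a b c : Fin n → A) :
    P.eval y (fun i => P.add (a i) (b i) (c i)) =
      P.add (P.eval y a) (P.eval y b) (P.eval y c) := by
  match n, y, a, b, c with
  | 0, y, _, _, _ => exact y.elim
  | n + 1, y, a, b, c =>
    refine P.toAt_injective (a 0) ?_
    simp only [toAt_eval, toAt_add, smul_sub, _root_.smul_add, Finset.sum_sub_distrib,
      Finset.sum_add_distrib]
    abel

/-- The congruence on `A × A` relating `(a, b)` to `(c, d)` if `b - a = d - c`. -/
def differenceCongruence : Congruence (Congruence.largest P.toModel).toModel where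
  rel p q := P.add p.1.1 p.1.2 q.1.1 = q.1.2
  equivalence := by
    refine ⟨fun p => P.maltsev_left _ _, fun {p q} h => ?_, fun {p q r} h h' => ?_⟩
    · refine P.toAt_injective p.1.1 ?_
      rw [toAt_add, ← h, toAt_add]
      abel
    · refine P.toAt_injective p.1.1 ?_
      rw [toAt_add, ← h', toAt_add, ← h, toAt_add]
      abel
  compat f a b h j := by
    change P.add (P.eval (f j) _) (P.eval (f j) _) (P.eval (f j) _) = P.eval (f j) _
    rw [← eval_add]
    exact congrArg _ (funext h)

theorem isAbelian_toModel : P.toModel.IsAbelian := by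
  refine fun x y => ⟨?_, fun h => h ▸ Congruence.commutator_refl _ _ _⟩
  rintro ⟨p, q, h, h₁, rfl, rfl⟩
  -- The difference congruence relates all diagonal pairs, hence contains `Δ`; pairs with the same
  -- first entry and the same difference are equal.
  have h₂ := h P.differenceCongruence fun x y _ => P.maltsev_right y x
  change P.add p.1.1 p.1.2 q.1.1 = q.1.2 at h₂
  rw [← h₁, P.maltsev_left] at h₂
  exact h₂

end Affinity

namespace LeftLinearForm

open AlgTheory

variable (D : LeftLinearForm.{u})

theorem isAbelian_theory : D.theory.IsAbelian := fun A S => by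
  rw [(corresponds_toAffinity S).eq_toModel]
  exact Affinity.isAbelian_toModel _

theorem isMaltsev_theory : D.theory.IsMaltsev := by
  -- `⟨0, -1, 1⟩(x, y, z) = x - (y - x) + (z - x) = x - y + z`.
  refine ⟨D.toOperation (Op.mk 0 ![-1, 1]), funext fun i => ?_, funext fun i => ?_⟩
  · obtain rfl := Subsingleton.elim i 0
    change D.subst (Op.mk 0 ![-1, 1]) (fun i => D.proj (![0, 1, 1] i)) = D.proj (0 : Fin 2)
    refine Op.ext ?_ fun j => ?_
    · simp [Op.const_subst]
    · fin_cases j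
      simp [Op.coeff_subst, Op.coeff_proj, Fin.sum_univ_succ]
  · obtain rfl := Subsingleton.elim i 0
    change D.subst (Op.mk 0 ![-1, 1]) (fun i => D.proj (![0, 0, 1] i)) = D.proj (1 : Fin 2)
    refine Op.ext ?_ fun j => ?_
    · simp [Op.const_subst]
    · fin_cases j
      simp [Op.coeff_subst, Op.coeff_proj, Fin.sum_univ_succ]

theorem hasNoNullary_theory : D.theory.HasNoNullary :=
  ⟨fun f => PEmpty.elim (f 0)⟩

theorem abelianMaltsev_theory : abelianMaltsev D.theory :=
  ⟨D.isAbelian_theory, D.isMaltsev_theory, D.hasNoNullary_theory⟩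

/-! ### Morphisms of theories of linear forms -/

@[simp] theorem const_freeAffinity_add {n : ℕ} (a b c : D.Op (n + 1)) :
    ((D.freeAffinity n).add a b c).const = b.const - a.const + c.const := rfl

@[simp] theorem coeff_freeAffinity_add {n : ℕ} (a b c : D.Op (n + 1)) (j : Fin n) :
    ((D.freeAffinity n).add a b c).coeff j = b.coeff j - a.coeff j + c.coeff j := rfl

@[simp] theorem const_freeAffinity_smul {n : ℕ} (r : D.R) (a b : D.Op (n + 1)) :
    ((D.freeAffinity n).smul r a b).const = a.const + r • (b.const - a.const) := rfl

@[simp] theorem coeff_freeAffinity_smul {n : ℕ} (r : D.R) (a b : D.Op (n + 1)) (j : Fin n) :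
    ((D.freeAffinity n).smul r a b).coeff j = a.coeff j + r * (b.coeff j - a.coeff j) := rfl

@[simp] theorem const_freeAffinity_phi {n : ℕ} (x : D.M) (a : D.Op (n + 1)) :
    ((D.freeAffinity n).phi x a).const = x + (1 - D.form x) • a.const := rfl

@[simp] theorem coeff_freeAffinity_phi {n : ℕ} (x : D.M) (a : D.Op (n + 1)) (j : Fin n) :
    ((D.freeAffinity n).phi x a).coeff j = (1 - D.form x) * a.coeff j := zero_add _

variable {D} {E : LeftLinearForm.{u}} (F : D.theory ⟶ E.theory)

/-- The action of a morphism of theories on operations. -/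
def mapOfTheory {n : ℕ} (y : D.Op n) : E.Op n :=
  AlgTheory.Morphism.map F (D.toOperation y) 0

theorem map_eq_mapOfTheory {n k : ℕ} (f : D.theory.Hom n k) (i : Fin k) :
    AlgTheory.Morphism.map F f i = mapOfTheory F (f i) := by
  have h := AlgTheory.Morphism.map_comp F f (D.theory.str fun _ : Fin 1 => i)
  rw [AlgTheory.Morphism.map_str] at h
  have h' : D.theory.comp f (D.theory.str fun _ : Fin 1 => i) = D.toOperation (f i) :=
    funext fun _ => D.subst_proj i f
  rw [h'] at h
  exact ((congrFun h 0).trans (E.subst_proj i _)).symm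

theorem mapOfTheory_proj {n : ℕ} (i : Fin n) : mapOfTheory F (D.proj i) = E.proj i :=
  congrFun (AlgTheory.Morphism.map_str F fun _ : Fin 1 => i) 0

theorem mapOfTheory_subst {k n : ℕ} (y : D.Op k) (z : Fin k → D.Op n) :
    mapOfTheory F (D.subst y z) = E.subst (mapOfTheory F y) (fun i => mapOfTheory F (z i)) := by
  refine (congrFun (AlgTheory.Morphism.map_comp F z (D.toOperation y)) 0).trans ?_
  exact congrArg (E.subst (mapOfTheory F y)) (funext fun i => map_eq_mapOfTheory F z i)

/-- The identities `e₀ +_{e₀} e₁ = e₁ = e₁ +_{e₀} e₀` are preserved by `F`. Comparing components in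
them forces the image to have constant part `0` and both coefficients `1`. -/
theorem mapOfTheory_mk_add :
    mapOfTheory F (Op.mk 0 ![1, 1] : D.Op 3) = Op.mk 0 ![1, 1] := by
  have h₁ : D.subst (Op.mk 0 ![1, 1]) ![D.proj 0, D.proj 0, D.proj (1 : Fin 2)] = D.proj 1 := by
    rw [subst_add, Affinity.zero_add]
  have h₂ : D.subst (Op.mk 0 ![1, 1]) ![D.proj 0, D.proj (1 : Fin 2), D.proj 0] = D.proj 1 := by
    rw [subst_add, Affinity.maltsev_left]
  have h₁' := congrArg (mapOfTheory F) h₁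
  have h₂' := congrArg (mapOfTheory F) h₂
  rw [mapOfTheory_subst, mapOfTheory_proj] at h₁' h₂'
  have h₃ := congrArg Op.const h₁'
  have h₄ := congrArg (fun y => Op.coeff y 0) h₁'
  have h₅ := congrArg (fun y => Op.coeff y 0) h₂'
  simp [Op.const_subst, Op.coeff_subst, Fin.sum_univ_succ, mapOfTheory_proj, Op.coeff_proj]
    at h₃ h₄ h₅
  refine Op.ext h₃ fun j => ?_
  fin_cases j
  · exact h₅
  · exact h₄

/-- The map of rings induced by a morphism of theories. -/
def ringMap (r : D.R) : E.R := (mapOfTheory F (Op.mk 0 ![r] : D.Op 2)).coeff 0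

/-- The map of modules induced by a morphism of theories. -/
def moduleMap (x : D.M) : E.M := (mapOfTheory F (Op.mk x ![] : D.Op 1)).const

/-- Idempotence `r_a a = a` is preserved and forces the constant part of the image to vanish. -/
theorem mapOfTheory_mk_smul (r : D.R) :
    mapOfTheory F (Op.mk 0 ![r] : D.Op 2) = Op.mk 0 ![ringMap F r] := by
  have h : D.subst (Op.mk 0 ![r]) ![D.proj 0, D.proj (0 : Fin 1)] = D.proj 0 := by
    rw [subst_smul, Affinity.smul_base]
  have h' := congrArg (fun y => (mapOfTheory F y).const) h
  simp only [mapOfTheory_subst, mapOfTheory_proj] at h'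
  simp [Op.const_subst, mapOfTheory_proj] at h'
  refine Op.ext h' fun j => ?_
  fin_cases j
  rfl

theorem mapOfTheory_mk_phi (x : D.M) :
    mapOfTheory F (Op.mk x ![] : D.Op 1) = Op.mk (moduleMap F x) ![] :=
  Op.ext rfl fun j => j.elim0

theorem mapOfTheory_add {n : ℕ} (a b c : D.Op (n + 1)) :
    mapOfTheory F ((D.freeAffinity n).add a b c) =
      (E.freeAffinity n).add (mapOfTheory F a) (mapOfTheory F b) (mapOfTheory F c) := by
  rw [← subst_add, mapOfTheory_subst, mapOfTheory_mk_add, ← subst_add]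
  congr 1
  funext i
  fin_cases i <;> rfl

theorem mapOfTheory_smul {n : ℕ} (r : D.R) (a b : D.Op (n + 1)) :
    mapOfTheory F ((D.freeAffinity n).smul r a b) =
      (E.freeAffinity n).smul (ringMap F r) (mapOfTheory F a) (mapOfTheory F b) := by
  rw [← subst_smul, mapOfTheory_subst, mapOfTheory_mk_smul, ← subst_smul]
  congr 1
  funext i
  fin_cases i <;> rfl

theorem mapOfTheory_phi {n : ℕ} (x : D.M) (a : D.Op (n + 1)) :
    mapOfTheory F ((D.freeAffinity n).phi x a) =
      (E.freeAffinity n).phi (moduleMap F x) (mapOfTheory F a) := by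
  rw [← subst_phi, mapOfTheory_subst, mapOfTheory_mk_phi, ← subst_phi]
  congr 1
  funext i
  fin_cases i
  rfl

/-- This form lets the module axioms of an affinity, carried through `F`, yield the ring
homomorphism laws by comparison of coefficients. -/
theorem ringMap_eq (r : D.R) : ringMap F r =
    (mapOfTheory F ((D.freeAffinity 1).smul r (D.proj 0) (D.proj 1))).coeff 0 := by
  rw [mapOfTheory_smul]
  simp [mapOfTheory_proj, Op.coeff_proj]

theorem moduleMap_eq (x : D.M) : moduleMap F x =
    (mapOfTheory F ((D.freeAffinity 0).phi x (D.proj 0))).const := by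
  rw [mapOfTheory_phi]
  simp [mapOfTheory_proj]

theorem ringMap_add (r s : D.R) : ringMap F (r + s) = ringMap F r + ringMap F s := by
  rw [ringMap_eq, Affinity.add_smul]
  simp [mapOfTheory_add, mapOfTheory_smul, mapOfTheory_proj, Op.coeff_proj]

theorem ringMap_mul (r s : D.R) : ringMap F (r * s) = ringMap F r * ringMap F s := by
  rw [ringMap_eq, ← Affinity.mul_smul]
  simp [mapOfTheory_smul, mapOfTheory_proj, Op.coeff_proj]

theorem ringMap_one : ringMap F (1 : D.R) = 1 := by
  rw [ringMap_eq, Affinity.one_smul]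
  simp [mapOfTheory_proj, Op.coeff_proj]

theorem moduleMap_add (x y : D.M) : moduleMap F (x + y) = moduleMap F x + moduleMap F y := by
  rw [moduleMap_eq, Affinity.phi_add]
  simp [mapOfTheory_add, mapOfTheory_phi, mapOfTheory_proj]

theorem moduleMap_smul (r : D.R) (x : D.M) :
    moduleMap F (r • x) = ringMap F r • moduleMap F x := by
  rw [moduleMap_eq, Affinity.phi_smul]
  simp [mapOfTheory_smul, mapOfTheory_phi, mapOfTheory_proj]

/-- The morphism of linear forms induced by a morphism of theories. -/
def morphismOfTheory : Morphism D E where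
  f := RingHom.mk' ⟨⟨ringMap F, ringMap_one F⟩, ringMap_mul F⟩ (ringMap_add F)
  g := AddMonoidHom.mk' (moduleMap F) (moduleMap_add F)
  map_smul := moduleMap_smul F
  comm x := by
    let f : D.R →+* E.R := RingHom.mk' ⟨⟨ringMap F, ringMap_one F⟩, ringMap_mul F⟩ (ringMap_add F)
    change E.form (moduleMap F x) = f (D.form x)
    -- In `φ_{e₁}(x) = φ_{e₀}(x) + (1 - ∂x) e₁`, the coefficient of `e₁` after applying `F` is `1 -
    -- ∂'(g x)` on the left and `1 - f(∂x)` on the right.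
    have h := congrArg (fun y => (mapOfTheory F y).coeff 0)
      ((D.freeAffinity 1).phi_change x (D.proj 0) (D.proj 1))
    have h' : ringMap F (1 - D.form x) = 1 - f (D.form x) := by
      change f (1 - D.form x) = _
      simp
    simp [mapOfTheory_add, mapOfTheory_smul, mapOfTheory_phi,
      mapOfTheory_proj, Op.coeff_proj, h'] at h
    exact h

theorem mapOp_morphismOfTheory {n : ℕ} (y : D.Op n) :
    (morphismOfTheory F).mapOp y = mapOfTheory F y := by
  match n, y with
  | 0, y => exact y.elim
  | n + 1, y =>
    refine Op.ext ?_ fun j => ?_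
    · change moduleMap F y.const = _
      have h : Op.mk y.const ![] = D.subst y fun _ => D.proj (0 : Fin 1) :=
        Op.ext (by simp [Op.const_subst]) fun j => j.elim0
      rw [moduleMap, h, mapOfTheory_subst]
      simp [Op.const_subst, mapOfTheory_proj]
    · change ringMap F (y.coeff j) = _
      -- Setting every variable except the one numbered `j.succ` to `e₀` isolates the coefficient
      -- `j` in a binary operation.
      have h : D.subst y (fun i => if i = j.succ then D.proj (1 : Fin 2) else D.proj 0) =
          (D.freeAffinity 1).add (D.proj 0) ((D.freeAffinity 1).phi y.const (D.proj 0))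
            ((D.freeAffinity 1).smul (y.coeff j) (D.proj 0) (D.proj 1)) := by
        refine Op.ext ?_ fun i => ?_
        · simp [Op.const_subst, Op.const_proj, apply_ite Op.const]
        · fin_cases i
          simp [Op.coeff_subst, apply_ite Op.coeff, ite_apply, Op.coeff_proj,
            (Fin.succ_ne_zero _).symm]
      have h' := congrArg (fun y => (mapOfTheory F y).coeff 0) h
      simp [mapOfTheory_subst, Op.coeff_subst, mapOfTheory_add, mapOfTheory_smul,
        mapOfTheory_phi, mapOfTheory_proj, Op.coeff_proj, apply_ite (mapOfTheory F),
        apply_ite Op.coeff, ite_apply, (Fin.succ_ne_zero _).symm] at h'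
      exact h'.symm

instance : theoryFunctor.{u}.Full where
  map_surjective F := by
    refine ⟨morphismOfTheory F, ?_⟩
    apply AlgTheory.Morphism.ext
    funext n k f i
    exact (mapOp_morphismOfTheory F (f i)).trans (map_eq_mapOfTheory F f i).symm

instance : theoryFunctor.{u}.Faithful where
  map_injective {D E F G} h := by
    have h' {n : ℕ} (y : D.Op n) : Morphism.mapOp F y = Morphism.mapOp G y := by
      exact congrArg (fun H : D.theory ⟶ E.theory => AlgTheory.Morphism.map H (D.toOperation y) 0) h
    apply Morphism.ext
    · ext r
      exact congrArg (fun y => Op.coeff y 0) (h' (Op.mk 0 ![r] : D.Op 2))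
    · ext x
      exact congrArg Op.const (h' (Op.mk x ![] : D.Op 1))

end LeftLinearForm

namespace AlgTheory

variable {T : AlgTheory.{u}}

/-! ### Free models -/

theorem hom_ext {n k : ℕ} {f g : T.Hom n k}
    (h : ∀ i, T.comp f (T.str fun _ : Fin 1 => i) = T.comp g (T.str fun _ : Fin 1 => i)) :
    f = g :=
  (T.isProduct n k).1 (funext h)

/-- The morphism with given components. -/
noncomputable def tuple {n k : ℕ} (a : Fin k → T.Operation n) : T.Hom n k :=
  ((T.isProduct n k).2 a).choose

theorem tuple_comp_str {n k : ℕ} (a : Fin k → T.Operation n) (i : Fin k) :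
    T.comp (tuple a) (T.str fun _ : Fin 1 => i) = a i :=
  congrFun ((T.isProduct n k).2 a).choose_spec i

/-- The `i`-th projection. -/
def var (T : AlgTheory.{u}) {n : ℕ} (i : Fin n) : T.Operation n := T.str fun _ => i

theorem tuple_var (n : ℕ) : tuple T.var = T.id n :=
  hom_ext fun i => by rw [tuple_comp_str, T.id_comp, var]

theorem str_eq_id (i : Fin 1) : T.str (fun _ : Fin 1 => i) = T.id 1 := by
  rw [← T.str_id]
  congr 1
  funext j
  exact Subsingleton.elim _ _

/-- The free model on `n` generators. -/
noncomputable def free (T : AlgTheory.{u}) (n : ℕ) : T.Model (T.Operation n) where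
  act f a j := T.comp (T.comp (tuple a) f) (T.str fun _ => j)
  act_id k a := funext fun j => by rw [T.comp_id, tuple_comp_str]
  act_comp f g a := funext fun j => by
    congr 1
    rw [← T.assoc]
    congr 1
    exact hom_ext fun i => by rw [tuple_comp_str]
  act_str f a := funext fun j => by rw [T.assoc, T.str_comp, tuple_comp_str]

theorem free_op {n k : ℕ} (f : T.Operation k) (a : Fin k → T.Operation n) :
    (T.free n).op f a = T.comp (tuple a) f := by
  change T.comp (T.comp (tuple a) f) (T.str fun _ => 0) = _
  rw [str_eq_id, T.comp_id]

theorem free_op_var {n : ℕ} (f : T.Operation n) : (T.free n).op f T.var = f := by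
  rw [free_op, tuple_var, T.id_comp]

variable {A : Type v} (S : T.Model A)

theorem Model.op_var {n : ℕ} (i : Fin n) (a : Fin n → A) : S.op (T.var i) a = a i :=
  S.op_str _ a

theorem Model.op_free_op {n k : ℕ} (f : T.Operation k) (a : Fin k → T.Operation n)
    (t : Fin n → A) : S.op ((T.free n).op f a) t = S.op f (fun i => S.op (a i) t) := by
  rw [free_op, op_comp]
  congr 1
  funext i
  rw [act_apply, tuple_comp_str]

theorem isIso_of_bijective {S T : AlgTheory.{u}} (F : S ⟶ T)
    (h : ∀ n, Function.Bijective
      (fun f : S.Operation n => (AlgTheory.Morphism.map F f : T.Operation n))) : IsIso F := by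
  have hb (n k : ℕ) : Function.Bijective
      (fun f : S.Hom n k => (AlgTheory.Morphism.map F f : T.Hom n k)) := by
    constructor
    · intro f g hfg
      refine hom_ext fun i => (h n).1 ?_
      have hfg : AlgTheory.Morphism.map F f = AlgTheory.Morphism.map F g := hfg
      simp only [AlgTheory.Morphism.map_comp F, hfg]
    · intro f
      choose g hg using fun i => (h n).2 (T.comp f (T.str fun _ : Fin 1 => i))
      refine ⟨tuple g, hom_ext fun i => ?_⟩
      have := AlgTheory.Morphism.map_comp F (tuple g) (S.str fun _ : Fin 1 => i)
      rw [tuple_comp_str, AlgTheory.Morphism.map_str] at this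
      exact this.symm.trans (hg i)
  let e (n k : ℕ) : S.Hom n k ≃ T.Hom n k := Equiv.ofBijective _ (hb n k)
  have he {n k : ℕ} (f : S.Hom n k) : e n k f = AlgTheory.Morphism.map F f := rfl
  let G : T ⟶ S :=
    { map := fun {n k} f => (e n k).symm f
      map_id := fun n => by rw [Equiv.symm_apply_eq, he, AlgTheory.Morphism.map_id]
      map_comp := fun f g => by
        rw [Equiv.symm_apply_eq, he, AlgTheory.Morphism.map_comp, ← he, ← he,
          Equiv.apply_symm_apply, Equiv.apply_symm_apply]
      map_str := fun f => by rw [Equiv.symm_apply_eq, he, AlgTheory.Morphism.map_str] }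
  refine ⟨G, ?_, ?_⟩
  · apply AlgTheory.Morphism.ext
    funext n k f
    exact (e n k).symm_apply_apply f
  · apply AlgTheory.Morphism.ext
    funext n k f
    exact (e n k).apply_symm_apply f

/-! ### Maltsev operations commuting with all operations -/

/-- A Maltsev operation that commutes with all operations. -/
structure CentralMaltsev (T : AlgTheory.{u}) where
  p : T.Operation 3
  left : T.comp (T.str (n := 2) ![0, 1, 1]) p = T.str (n := 2) ![0]
  right : T.comp (T.str (n := 2) ![0, 0, 1]) p = T.str (n := 2) ![1]
  -- Models in the universe of the operations suffice, since the free models lie there.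
  comm : ∀ {A : Type u} (S : T.Model A) {n : ℕ} (f : T.Operation n) (a b c : Fin n → A),
    S.op f (fun i => S.op p ![a i, b i, c i]) = S.op p ![S.op f a, S.op f b, S.op f c]

theorem Model.op_maltsev_left {p : T.Operation 3}
    (hp : T.comp (T.str (n := 2) ![0, 1, 1]) p = T.str (n := 2) ![0]) (x y : A) :
    S.op p ![x, y, y] = x := by
  have h := congrArg (fun f => S.op f ![x, y]) hp
  simp only [op_comp, op_str, S.act_str] at h
  refine Eq.trans ?_ h
  congr 1
  funext i
  fin_cases i <;> rfl

theorem Model.op_maltsev_right {p : T.Operation 3}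
    (hp : T.comp (T.str (n := 2) ![0, 0, 1]) p = T.str (n := 2) ![1]) (x y : A) :
    S.op p ![y, y, x] = x := by
  have h := congrArg (fun f => S.op f ![y, x]) hp
  simp only [op_comp, op_str, S.act_str] at h
  refine Eq.trans ?_ h
  congr 1
  funext i
  fin_cases i <;> rfl

theorem Congruence.compat_op {S : T.Model A} (C : Congruence S) {n : ℕ} (f : T.Operation n)
    {a b : Fin n → A} (h : ∀ i, C.rel (a i) (b i)) : C.rel (S.op f a) (S.op f b) :=
  C.compat f a b h 0

/-- In any congruence `C` occurring in the definition of `Δ`, `(x, y)` is related to `(z, p(y, x,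
z))`. Applying this before and after `f` relates both sides of the claim, each paired with the first
entry `f(c)`; the trivial commutator then makes them equal. -/
theorem Model.IsAbelian.op_comm {S : T.Model A} (hS : S.IsAbelian) {p : T.Operation 3}
    (left : T.comp (T.str (n := 2) ![0, 1, 1]) p = T.str (n := 2) ![0])
    (right : T.comp (T.str (n := 2) ![0, 0, 1]) p = T.str (n := 2) ![1])
    {n : ℕ} (f : T.Operation n) (a b c : Fin n → A) :
    S.op f (fun i => S.op p ![a i, b i, c i]) = S.op p ![S.op f a, S.op f b, S.op f c] := by
  let pair (x y : A) : {q : A × A // (Congruence.largest S).rel q.1 q.2} := ⟨(x, y), trivial⟩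
  have op_pair {k : ℕ} (g : T.Operation k) (x y : Fin k → A) :
      (Congruence.largest S).toModel.op g (fun i => pair (x i) (y i)) =
        pair (S.op g x) (S.op g y) := rfl
  refine (hS _ _).1 ⟨pair (S.op f c) (S.op f fun i => S.op p ![a i, b i, c i]),
    pair (S.op f c) (S.op p ![S.op f a, S.op f b, S.op f c]), fun C hC => ?_, rfl, rfl, rfl⟩
  have key (x y z : A) : C.rel (pair x y) (pair z (S.op p ![y, x, z])) := by
    -- Apply `p` to `(x, y)`, `(x, x)`, `(z, z)` and to `(x, y)`, `(x, x)`, `(x, x)`, where only the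
    -- third diagonal pair changes.
    have h := C.compat_op p (a := fun i => pair (![x, x, z] i) (![y, x, z] i))
      (b := fun i => pair (![x, x, x] i) (![y, x, x] i)) fun i => by
        fin_cases i
        · exact C.equivalence.refl _
        · exact C.equivalence.refl _
        · exact hC z x trivial
    rw [op_pair, op_pair, S.op_maltsev_right right, S.op_maltsev_right right,
      S.op_maltsev_left left] at h
    exact C.equivalence.symm h
  have h := C.compat_op f fun i => key (b i) (a i) (c i)
  rw [op_pair, op_pair] at h
  exact C.equivalence.trans (C.equivalence.symm h) (key _ _ _)

theorem exists_centralMaltsev (h : T.IsAbelian) (h' : T.IsMaltsev) :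
    Nonempty T.CentralMaltsev := by
  obtain ⟨p, left, right⟩ := h'
  exact ⟨⟨p, left, right, fun S => (h _ S).op_comm left right⟩⟩

namespace CentralMaltsev

variable (H : T.CentralMaltsev)

section Herd

variable {A : Type u} (S : T.Model A)

/-- The ternary operation of a model given by the Maltsev operation. -/
def m (x y z : A) : A := S.op H.p ![x, y, z]

theorem m_left (x y : A) : H.m S x y y = x := S.op_maltsev_left H.left x y

theorem m_right (x y : A) : H.m S y y x = x := S.op_maltsev_right H.right x y

theorem op_m {n : ℕ} (f : T.Operation n) (a b c : Fin n → A) :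
    S.op f (fun i => H.m S (a i) (b i) (c i)) = H.m S (S.op f a) (S.op f b) (S.op f c) :=
  H.comm S f a b c

/-- The operation `p` commutes with itself; commutativity and associativity follow by filling the
3×3 array so that the Maltsev identities collapse rows and columns. -/
theorem m_m (a₁ b₁ c₁ a₂ b₂ c₂ a₃ b₃ c₃ : A) :
    H.m S (H.m S a₁ b₁ c₁) (H.m S a₂ b₂ c₂) (H.m S a₃ b₃ c₃) =
      H.m S (H.m S a₁ a₂ a₃) (H.m S b₁ b₂ b₃) (H.m S c₁ c₂ c₃) := by
  refine Eq.trans ?_ (H.op_m S H.p ![a₁, a₂, a₃] ![b₁, b₂, b₃] ![c₁, c₂, c₃])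
  rw [m]
  congr 1
  funext i
  fin_cases i <;> rfl

theorem m_comm (x y z : A) : H.m S x y z = H.m S z y x := by
  have h := H.m_m S y y x y y y z y y
  simpa only [m_left, m_right] using h

theorem m_assoc (t s x y z : A) : H.m S t s (H.m S x y z) = H.m S (H.m S t s x) y z := by
  have h := H.m_m S t s x s s y s s z
  simpa only [m_left, m_right] using h.symm

theorem m_neg_cancel (a x : A) : H.m S (H.m S a x a) a x = a := by
  rw [← m_assoc, m_right, m_left]

/-- The set underlying a model, with `a` regarded as base point. -/
def Base (_ : T.CentralMaltsev) {A : Type u} (_ : T.Model A) (_ : A) : Type u := A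

variable (a : A)

instance : Zero (H.Base S a) := ⟨a⟩

instance : Add (H.Base S a) := ⟨fun x y => H.m S x a y⟩

instance : Neg (H.Base S a) := ⟨fun x => H.m S a x a⟩

instance : AddCommGroup (H.Base S a) where
  add_assoc x y z := (H.m_assoc S x a y a z).symm
  zero_add x := H.m_right S x a
  add_zero x := H.m_left S x a
  add_comm x y := H.m_comm S x a y
  neg_add_cancel x := H.m_neg_cancel S a x
  nsmul := nsmulRec
  zsmul := zsmulRec

/-- An element, regarded as an element of the group with base point `a`. -/
def toBase (x : A) : H.Base S a := x

theorem toBase_injective {x y : A} (h : H.toBase S a x = H.toBase S a y) : x = y := h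

theorem toBase_self : H.toBase S a a = 0 := rfl

theorem toBase_m (x y z : A) :
    H.toBase S a (H.m S x y z) = H.toBase S a x - H.toBase S a y + H.toBase S a z := by
  rw [sub_eq_add_neg]
  change H.m S x y z = H.m S (H.m S x a (H.m S a y a)) a z
  rw [H.m_assoc S x a a y a, m_left, ← m_assoc, m_right]

theorem toBase_op_m {n : ℕ} (f : T.Operation n) (x y z : Fin n → A) :
    H.toBase S a (S.op f fun i => H.m S (x i) (y i) (z i)) =
      H.toBase S a (S.op f x) - H.toBase S a (S.op f y) + H.toBase S a (S.op f z) := by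
  rw [op_m, toBase_m]

end Herd

/-! ### The linear form of an abelian Maltsev theory -/

section Evaluation

variable {A : Type u} (S : T.Model A)

theorem op_free_m {n : ℕ} (x y z : T.Operation n) (t : Fin n → A) :
    S.op (H.m (T.free n) x y z) t = H.m S (S.op x t) (S.op y t) (S.op z t) := by
  rw [m, S.op_free_op, m]
  congr 1
  funext i
  fin_cases i <;> rfl

theorem op_free_op_two {n : ℕ} (f : T.Operation 2) (x y : T.Operation n) (t : Fin n → A) :
    S.op ((T.free n).op f ![x, y]) t = S.op f ![S.op x t, S.op y t] := by
  rw [S.op_free_op]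
  congr 1
  funext i
  fin_cases i <;> rfl

theorem op_free_op_one {n : ℕ} (f : T.Operation 1) (x : T.Operation n) (t : Fin n → A) :
    S.op ((T.free n).op f ![x]) t = S.op f ![S.op x t] := by
  rw [S.op_free_op]
  congr 1
  funext i
  fin_cases i
  rfl

end Evaluation

theorem op_m_of_op_eq {r s t : T.Operation 2}
    (hr : (T.free 1).op r (fun _ => T.var 0) = T.var 0)
    (hs : (T.free 1).op s (fun _ => T.var 0) = T.var 0)
    (ht : (T.free 1).op t (fun _ => T.var 0) = T.var 0) :
    (T.free 1).op (H.m (T.free 2) r s t) (fun _ => T.var 0) = T.var 0 := by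
  rw [op_free_m, hr, hs, ht, m_left]

/-- The additive group of idempotent binary operations. -/
def scalars : AddSubgroup (H.Base (T.free 2) (T.var 0)) where
  -- This is the kernel of the evaluation from two generators to one, both sent to the same
  -- variable.
  carrier := {r | (T.free 1).op (n := 2) r (fun _ => T.var 0) = T.var 0}
  zero_mem' := (T.free 1).op_var _ _
  add_mem' hr hs := H.op_m_of_op_eq hr ((T.free 1).op_var _ _) hs
  neg_mem' hr := H.op_m_of_op_eq ((T.free 1).op_var _ _) hr ((T.free 1).op_var _ _)

/-- The ring of idempotent binary operations. -/
def Scalar : Type u := H.scalars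

noncomputable instance : AddCommGroup H.Scalar := inferInstanceAs (AddCommGroup H.scalars)

/-- A scalar as binary operation. -/
def Scalar.operation {H : T.CentralMaltsev} (r : H.Scalar) : T.Operation 2 := r.1

variable {H}

/-- The scalar given by an idempotent binary operation. -/
def Scalar.mk (r : T.Operation 2) (h : (T.free 1).op r (fun _ => T.var 0) = T.var 0) :
    H.Scalar := ⟨r, h⟩

theorem Scalar.op_self {A : Type v} (S : T.Model A) (r : H.Scalar) (t : Fin 2 → A)
    (ht : t 0 = t 1) : S.op r.operation t = t 0 := by
  have h : (T.free 1).op r.operation (fun _ => T.var 0) = T.var 0 := r.2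
  have h' := congrArg (fun f => S.op f (fun _ => t 0)) h
  simp only [S.op_free_op, S.op_var] at h'
  refine Eq.trans ?_ h'
  congr 1
  funext i
  fin_cases i
  · rfl
  · exact ht.symm

instance : One H.Scalar := ⟨Scalar.mk (T.var 1) ((T.free 1).op_var _ _)⟩

noncomputable instance : Mul H.Scalar :=
  ⟨fun r s => Scalar.mk ((T.free 2).op r.operation ![T.var 0, s.operation]) (by
    have h : (T.free 1).op s.operation (fun _ => T.var 0) = T.var 0 := s.2
    rw [op_free_op_two, h, Model.op_var]
    exact Scalar.op_self _ r _ rfl)⟩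

section Module

variable {A : Type u} (S : T.Model A) (a : A)

instance : SMul H.Scalar (H.Base S a) :=
  ⟨fun r b => S.op r.operation ![a, b]⟩

theorem smul_def (r : H.Scalar) (b : A) :
    r • H.toBase S a b = H.toBase S a (S.op r.operation ![a, b]) := rfl

theorem scalar_one_smul (b : H.Base S a) : (1 : H.Scalar) • b = b :=
  S.op_var 1 ![a, b]

theorem scalar_mul_smul (r s : H.Scalar) (b : H.Base S a) : (r * s) • b = r • s • b := by
  refine (op_free_op_two S r.operation _ _ _).trans ?_
  rw [S.op_var]
  rfl

theorem scalar_add_smul (r s : H.Scalar) (b : H.Base S a) : (r + s) • b = r • b + s • b := by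
  refine (H.op_free_m S _ _ _ _).trans ?_
  rw [S.op_var]
  rfl

theorem scalar_zero_smul (b : H.Base S a) : (0 : H.Scalar) • b = 0 :=
  S.op_var 0 ![a, b]

theorem scalar_smul_zero (r : H.Scalar) : r • (0 : H.Base S a) = 0 :=
  Scalar.op_self S r ![a, a] rfl

theorem scalar_smul_add (r : H.Scalar) (b c : H.Base S a) : r • (b + c) = r • b + r • c := by
  have h := H.op_m S r.operation ![a, b] ![a, a] ![a, c]
  rw [Scalar.op_self S r ![a, a] rfl] at h
  refine Eq.trans ?_ h
  refine congrArg (S.op r.operation) (funext fun i => ?_)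
  fin_cases i
  · exact (H.m_left S a a).symm
  · rfl

end Module

/-- A scalar as an element of the free model on two generators. -/
def Scalar.toBase (r : H.Scalar) : H.Base (T.free 2) (T.var 0) := r.1

theorem Scalar.toBase_injective {r s : H.Scalar} (h : r.toBase = s.toBase) : r = s :=
  Subtype.ext h

/-- The second variable generates: a scalar acting on it is the scalar itself. Equality of scalars
can therefore be tested on this one element. -/
theorem Scalar.smul_toBase_one (r : H.Scalar) : r • (1 : H.Scalar).toBase = r.toBase := by
  change (T.free 2).op r.operation ![T.var 0, T.var 1] = r.operation
  refine Eq.trans ?_ (free_op_var r.operation)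
  congr 1
  funext i
  fin_cases i <;> rfl

noncomputable instance : Ring H.Scalar :=
  { (inferInstance : AddCommGroup H.Scalar) with
    mul := (· * ·)
    one := 1
    -- Multiplication of scalars is their action on scalars inside the free model on two generators,
    -- so the ring axioms are instances of the action laws.
    left_distrib := fun r s t => Scalar.toBase_injective (scalar_smul_add _ _ _ _ _)
    right_distrib := fun r s t => Scalar.toBase_injective (scalar_add_smul _ _ _ _ _)
    zero_mul := fun r => Scalar.toBase_injective (scalar_zero_smul _ _ _)
    mul_zero := fun r => Scalar.toBase_injective (scalar_smul_zero _ _ _)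
    mul_assoc := fun r s t => Scalar.toBase_injective (scalar_mul_smul _ _ _ _ _)
    one_mul := fun r => Scalar.toBase_injective (scalar_one_smul _ _ _)
    mul_one := fun r => Scalar.toBase_injective r.smul_toBase_one }

instance {A : Type u} (S : T.Model A) (a : A) : Module H.Scalar (H.Base S a) where
  one_smul := scalar_one_smul S a
  mul_smul := scalar_mul_smul S a
  smul_zero := scalar_smul_zero S a
  smul_add := scalar_smul_add S a
  add_smul := scalar_add_smul S a
  zero_smul := scalar_zero_smul S a

variable (H)

/-- The module of unary operations. -/
abbrev UnaryModule : Type u := H.Base (T.free 1) (T.var 0)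

/-- A unary operation of the module. -/
def UnaryModule.operation {H : T.CentralMaltsev} (x : H.UnaryModule) : T.Operation 1 := x

/-- Evaluation of unary operations at `a`. -/
def phi {A : Type u} (S : T.Model A) (a : A) : H.UnaryModule →ₗ[H.Scalar] H.Base S a where
  toFun x := S.op x.operation ![a]
  map_add' x y := by
    refine (H.op_free_m S _ _ _ _).trans ?_
    rw [S.op_var]
    rfl
  map_smul' r x := by
    refine (op_free_op_two S r.operation _ _ _).trans ?_
    rw [S.op_var]
    rfl

/-- The scalar `∂ x`, given by `(a, b) ↦ b - x b + x a`. -/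
noncomputable def formScalar (x : H.UnaryModule) : H.Scalar :=
  -- This choice is forced by `phi_change`, which in the module at `a` reads `x(b) = x(a) + (1 - ∂x)
  -- b`.
  Scalar.mk (H.m (T.free 2) (T.var 1) ((T.free 2).op x.operation ![T.var 1])
    ((T.free 2).op x.operation ![T.var 0])) (by
      rw [op_free_m, op_free_op_one, op_free_op_one, Model.op_var, Model.op_var, m_left])

theorem formScalar_smul {A : Type u} (S : T.Model A) (a b : A) (x : H.UnaryModule) :
    H.formScalar x • H.toBase S a b =
      H.toBase S a b - H.toBase S a (S.op x.operation ![b]) +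
        H.toBase S a (S.op x.operation ![a]) := by
  rw [← toBase_m, smul_def]
  congr 1
  refine (H.op_free_m S _ _ _ _).trans ?_
  rw [op_free_op_one, op_free_op_one, S.op_var, S.op_var]
  rfl

/-- Change of base point for scalar multiplication. -/
theorem toBase_op_scalar {A : Type u} (S : T.Model A) (r : H.Scalar) (a a' b : A) :
    H.toBase S a (S.op r.operation ![a', b]) =
      H.toBase S a a' + r • (H.toBase S a b - H.toBase S a a') := by
  -- Write `(a', b) = (a, b - a' + a) - (a, a) + (a', a')` and use that `r` commutes with `m`;
  -- idempotence evaluates the last two pairs.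
  have h := H.toBase_op_m S a r.operation ![a, H.m S b a' a] ![a, a] ![a', a']
  rw [Scalar.op_self S r ![a, a] rfl, Scalar.op_self S r ![a', a'] rfl] at h
  have h₁ : (fun i => H.m S (![a, H.m S b a' a] i) (![a, a] i) (![a', a'] i)) = ![a', b] := by
    funext i
    fin_cases i
    · exact H.m_right S _ _
    · change H.m S (H.m S b a' a) a a' = b
      rw [← m_assoc, m_right, m_left]
  rw [h₁] at h
  rw [h, ← smul_def, toBase_m]
  change _ - H.toBase S a a + H.toBase S a a' = _
  rw [toBase_self, add_zero, sub_zero, add_comm]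

theorem scalar_eq_of_smul {r s : H.Scalar}
    (h : r • H.toBase (T.free 2) (T.var 0) (T.var 1) =
      s • H.toBase (T.free 2) (T.var 0) (T.var 1)) : r = s :=
  Scalar.toBase_injective (r.smul_toBase_one.symm.trans (h.trans s.smul_toBase_one))

/-- The linear form of a theory with a Maltsev operation commuting with all operations. -/
noncomputable def form : H.UnaryModule →ₗ[H.Scalar] H.Scalar where
  toFun := H.formScalar
  map_add' x y := by
    refine H.scalar_eq_of_smul ?_
    have h (a : T.Operation 2) : (T.free 2).op (x + y).operation ![a] =
        H.m (T.free 2) ((T.free 2).op x.operation ![a]) a ((T.free 2).op y.operation ![a]) :=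
      (H.phi (T.free 2) a).map_add x y
    rw [add_smul, formScalar_smul, formScalar_smul, formScalar_smul, h, h, toBase_m, toBase_m,
      toBase_self]
    abel
  map_smul' r x := by
    refine H.scalar_eq_of_smul ?_
    have h (a : T.Operation 2) : (T.free 2).op (r • x).operation ![a] =
        (T.free 2).op r.operation ![a, (T.free 2).op x.operation ![a]] :=
      (H.phi (T.free 2) a).map_smul r x
    rw [RingHom.id_apply, smul_eq_mul, SemigroupAction.mul_smul, formScalar_smul,
      formScalar_smul, h, h, toBase_op_scalar, toBase_op_scalar, toBase_self]
    simp only [smul_sub, smul_add, smul_zero]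
    abel

/-- The left linear form of a theory with a Maltsev operation commuting with all operations. -/
noncomputable def linearForm : LeftLinearForm.{u} where
  R := H.Scalar
  M := H.UnaryModule
  form := H.form

/-- Every model is an affinity. -/
def affinity {A : Type u} (S : T.Model A) : Affinity H.linearForm A where
  add a b c := H.m S b a c
  smul (r : H.Scalar) a b := S.op r.operation ![a, b]
  phi (x : H.UnaryModule) a := S.op x.operation ![a]
  maltsev_left x y := H.m_left S x y
  maltsev_right x y := H.m_right S x y
  herd_assoc t s x y z := H.m_assoc S t s x y z
  herd_comm x y z := H.m_comm S x y z
  add_assoc a b c d := H.m_assoc S b a c a d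
  zero_add a b := H.m_right S b a
  add_comm a b c := H.m_comm S b a c
  sub_self a b := (congrArg (fun c => H.toBase S a b + c)
    ((neg_smul (1 : H.Scalar) (H.toBase S a b)).trans
      (congrArg _ (one_smul _ _)))).trans (add_neg_cancel (H.toBase S a b))
  smul_add r a b c := scalar_smul_add (H := H) S a r b c
  add_smul r s a b := scalar_add_smul (H := H) S a r s b
  one_smul a b := scalar_one_smul (H := H) S a b
  mul_smul r s a b := (scalar_mul_smul (H := H) S a r s b).symm
  phi_add x y a := (H.phi S a).map_add x y
  phi_smul r x a := (H.phi S a).map_smul r x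
  add_change a a' b c := by
    have h (x : A) : S.op (-1 : H.Scalar).operation ![a, x] = H.m S a x a :=
      ((neg_smul (1 : H.Scalar) (H.toBase S a x)).trans (congrArg _ (one_smul _ _)))
    change _ = H.m S (H.m S (H.m S b a (S.op (-1 : H.Scalar).operation ![a, a'])) a
      (H.m S c a (S.op (-1 : H.Scalar).operation ![a, a']))) a a'
    refine H.toBase_injective S a ?_
    simp only [h, toBase_m, toBase_self]
    abel
  smul_change (r : H.Scalar) a a' b := by
    have h (x : A) : S.op (-1 : H.Scalar).operation ![a, x] = H.m S a x a :=
      ((neg_smul (1 : H.Scalar) (H.toBase S a x)).trans (congrArg _ (one_smul _ _)))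
    change _ = H.m S (S.op r.operation
      ![a, H.m S b a (S.op (-1 : H.Scalar).operation ![a, a'])]) a a'
    refine H.toBase_injective S a ?_
    rw [toBase_op_scalar, h, toBase_m, ← smul_def, toBase_m, toBase_m, toBase_self]
    simp only [zero_sub, sub_zero, add_zero, smul_sub, smul_add, smul_neg]
    abel
  phi_change (x : H.UnaryModule) a a' := by
    change _ = H.m S (S.op x.operation ![a]) a
      (S.op (1 - H.formScalar x : H.Scalar).operation ![a, a'])
    refine H.toBase_injective S a ?_
    rw [toBase_m, ← smul_def, sub_smul, formScalar_smul, one_smul, toBase_self]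
    abel

end CentralMaltsev

end AlgTheory

/-! ### An abelian Maltsev theory is the theory of its linear form -/

namespace AlgTheory

namespace CentralMaltsev

variable {T : AlgTheory.{u}} (H : T.CentralMaltsev)

theorem isHom_affinity {k : ℕ} {A : Type u} (S : T.Model A) (t : Fin k → A) :
    (H.affinity (T.free k)).IsHom (H.affinity S) (fun f => S.op f t) :=
  ⟨fun _ _ _ => H.op_free_m S _ _ _ t, fun _ _ _ => op_free_op_two S _ _ _ t,
    fun _ _ => op_free_op_one S _ _ t⟩

/-- The interpretation of the operations over the linear form of `T` as operations of `T`. -/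
noncomputable def interpret {n : ℕ} (y : H.linearForm.Op n) : T.Operation n :=
  (H.affinity (T.free n)).eval y T.var

theorem op_interpret {n : ℕ} {A : Type u} (S : T.Model A) (y : H.linearForm.Op n)
    (t : Fin n → A) : S.op (H.interpret y) t = (H.affinity S).eval y t := by
  refine ((H.isHom_affinity S t).map_eval y T.var).trans ?_
  simp only [S.op_var]

theorem interpret_subst {k n : ℕ} (y : H.linearForm.Op k) (z : Fin k → H.linearForm.Op n) :
    H.interpret (H.linearForm.subst y z) =
      (T.free n).op (H.interpret y) (fun i => H.interpret (z i)) := by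
  rw [op_interpret]
  exact Affinity.eval_subst _ y z T.var

theorem interpret_proj {n : ℕ} (i : Fin n) : H.interpret (H.linearForm.proj i) = T.var i :=
  Affinity.eval_proj _ i _

/-- The canonical morphism from the theory of the linear form of `T` to `T`. -/
noncomputable def interpretation : H.linearForm.theory ⟶ T where
  map f := tuple fun i => H.interpret (f i)
  map_id n := (congrArg tuple (funext H.interpret_proj)).trans (tuple_var n)
  map_comp f g := hom_ext fun i => by
    rw [T.assoc, tuple_comp_str, tuple_comp_str, ← free_op]
    exact H.interpret_subst (g i) f
  map_str f := hom_ext fun i => by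
    rw [tuple_comp_str, T.str_comp]
    exact H.interpret_proj (f i)

open LeftLinearForm

/-- Setting all variables equal recovers `x`; letting only the variable `j.succ` differ from the
others then recovers `rⱼ`, after cancelling the constant part. -/
theorem interpret_injective (n : ℕ) :
    Function.Injective (H.interpret : H.linearForm.Op n → T.Operation n) := by
  intro y z h
  match n, y, z, h with
  | 0, y, _, _ => exact y.elim
  | n + 1, y, z, h =>
    have hc (w : H.linearForm.Op (n + 1)) :
        (T.free 1).op (H.interpret w) (fun _ => T.var 0) = w.const := by
      rw [op_interpret]
      refine (H.affinity (T.free 1)).toAt_injective (T.var 0) ?_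
      rw [Affinity.toAt_eval]
      simp only [Affinity.toAt_self, smul_zero, add_zero, sub_zero, Finset.sum_const_zero]
      let x : T.Operation 1 := w.const
      change (T.free 1).op x ![T.var 0] = x
      refine Eq.trans ?_ (free_op_var x)
      congr 1
      funext i
      fin_cases i
      rfl
    have hconst : y.const = z.const := by rw [← hc, ← hc, h]
    refine Op.ext hconst fun j => Scalar.toBase_injective (H := H) ?_
    let P := H.affinity (T.free 2)
    have hj (w : H.linearForm.Op (n + 1)) :
        P.toAt (T.var 0) ((T.free 2).op (H.interpret w)
            (fun i => if i = j.succ then T.var 1 else T.var 0)) =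
          P.phiLinear (T.var 0) w.const + w.coeff j • P.toAt (T.var 0) (T.var 1) := by
      rw [op_interpret, Affinity.toAt_eval]
      simp [(Fin.succ_ne_zero j).symm, Affinity.toAt_self, apply_ite (P.toAt (T.var 0)), P]
    have h' := hj y
    rw [h, hj z, hconst] at h'
    have h'' := add_left_cancel h'
    exact ((Scalar.smul_toBase_one (H := H) _).symm.trans h''.symm).trans
      (Scalar.smul_toBase_one (H := H) _)

theorem interpret_surjective (h₀ : T.HasNoNullary) (n : ℕ) :
    Function.Surjective (H.interpret : H.linearForm.Op n → T.Operation n) := by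
  intro f
  match n, f with
  | 0, f => exact (h₀.false f).elim
  | n + 1, f =>
    -- The constant part is `f` on the diagonal, and `rⱼ` is the increment of `f` when only the
    -- variable `j.succ` moves away from the base point.
    let c : T.Operation 1 := (T.free 1).op f fun _ => T.var 0
    let r (j : Fin n) : H.Scalar := Scalar.mk (H.m (T.free 2)
      ((T.free 2).op f fun i => if i = j.succ then T.var 1 else T.var 0)
      ((T.free 2).op f fun _ => T.var 0) (T.var 0)) (by
        rw [op_free_m, Model.op_free_op, Model.op_free_op]
        simp only [apply_ite (fun g => (T.free 1).op g fun _ => T.var 0), Model.op_var, ite_self]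
        rw [m_right])
    refine ⟨Op.mk c r, ?_⟩
    let S := T.free (n + 1)
    let P := H.affinity S
    let a : T.Operation (n + 1) := T.var 0
    have hc : P.phiLinear a c = P.toAt a (S.op f fun _ => a) := by
      change S.op ((T.free 1).op f fun _ => T.var 0) ![a] = _
      rw [Model.op_free_op]
      simp only [Model.op_var]
      rfl
    -- As `f` commutes with `m`, it becomes additive once its value at the constant tuple `a` is
    -- subtracted. It is thus determined by tuples with a single nonzero entry.
    let g : (Fin (n + 1) → P.At a) →+ P.At a := AddMonoidHom.mk'
      (fun u => P.toAt a (S.op f u) - P.toAt a (S.op f fun _ => a)) fun u v => by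
        have h : P.toAt a (S.op f (u + v)) = P.toAt a (H.m S (S.op f u) (S.op f fun _ => a)
          (S.op f v)) := H.op_m S f u (fun _ => a) v
        have h' : P.toAt a (H.m S (S.op f u) (S.op f fun _ => a) (S.op f v)) =
          _ := P.toAt_add a (S.op f fun _ => a) (S.op f u) (S.op f v)
        rw [h, h']
        abel
    have hr (j : Fin n) : (show H.linearForm.R from r j) • P.toAt a (T.var j.succ) =
        g (Pi.single j.succ (P.toAt a (T.var j.succ))) := by
      have h₁ : (show H.linearForm.R from r j) • P.toAt a (T.var j.succ) =
          P.toAt a (H.m S (S.op f fun i => if i = j.succ then T.var j.succ else a)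
            (S.op f fun _ => a) a) := by
        change S.op (H.m (T.free 2) _ _ _) ![a, T.var j.succ] = _
        rw [op_free_m, Model.op_free_op, Model.op_free_op]
        simp only [apply_ite (fun g => S.op g ![a, T.var j.succ]), Model.op_var]
        rfl
      rw [h₁]
      refine (P.toAt_add a _ _ _).trans ?_
      rw [Affinity.toAt_self, add_zero]
      change _ = P.toAt a (S.op f _) - _
      congr 3
      funext i
      rw [Pi.single_apply]
      rfl
    refine P.toAt_injective a ?_
    have hf : P.toAt a f = g (fun i => P.toAt a (T.var i)) + P.toAt a (S.op f fun _ => a) := by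
      change _ = P.toAt a (S.op f T.var) - _ + _
      rw [sub_add_cancel, free_op_var]
    rw [hf, ← Finset.univ_sum_single (fun i => P.toAt a (T.var i)), map_sum, Fin.sum_univ_succ]
    -- The first variable is the base point, so its summand drops out and `n` coefficients remain
    -- for arity `n + 1`.
    have h0 : P.toAt a (T.var 0) = 0 := P.toAt_self a
    rw [h0, Pi.single_zero, map_zero, zero_add]
    have he : P.toAt a (H.interpret (Op.mk c r)) = _ := P.toAt_eval a _ _
    rw [he, h0]
    simp only [smul_zero, add_zero, sub_zero, ← hr]
    exact (congrArg (fun b => b + _) hc).trans (add_comm (G := P.At a) _ _)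

theorem isIso_interpretation (h₀ : T.HasNoNullary) : IsIso H.interpretation := by
  refine isIso_of_bijective _ fun n => ?_
  have h (f : H.linearForm.theory.Operation n) :
      (AlgTheory.Morphism.map H.interpretation f : T.Operation n) = H.interpret (f 0) := by
    change tuple _ = _
    have h' := tuple_comp_str (T := T) (fun i => H.interpret (f i)) 0
    rwa [str_eq_id, T.comp_id] at h'
  constructor
  · intro f g hfg
    funext i
    rw [Subsingleton.elim i 0]
    refine H.interpret_injective n ?_
    rw [← h, ← h]
    exact hfg
  · intro f
    obtain ⟨y, hy⟩ := H.interpret_surjective h₀ n f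
    exact ⟨H.linearForm.toOperation y, (h _).trans hy⟩

end CentralMaltsev

end AlgTheory

/-! ### The equivalence and the main theorem -/

open LeftLinearForm in
theorem LeftLinearForm.essSurj_lift_theoryFunctor
    (h : ∀ D : LeftLinearForm.{u}, AlgTheory.abelianMaltsev (theoryFunctor.obj D)) :
    (AlgTheory.abelianMaltsev.lift theoryFunctor h).EssSurj where
  mem_essImage T := by
    obtain ⟨h₁, h₂, h₃⟩ := T.property
    obtain ⟨H⟩ := AlgTheory.exists_centralMaltsev h₁ h₂
    exact ⟨H.linearForm, ⟨AlgTheory.abelianMaltsev.isoMk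
      (@asIso _ _ _ _ H.interpretation (H.isIso_interpretation h₃))⟩⟩

theorem mainTheorem3 :
    (∃ h : ∀ D : LeftLinearForm.{u},
        AlgTheory.abelianMaltsev (LeftLinearForm.theoryFunctor.obj D),
      (AlgTheory.abelianMaltsev.lift LeftLinearForm.theoryFunctor h).IsEquivalence) ∧
    (∀ D : LeftLinearForm.{u},
      (∀ (A : Type v) (P : Affinity D A), ∃! S : D.theory.Model A, P.Corresponds S) ∧
      (∀ (A : Type v) (S : D.theory.Model A), ∃! P : Affinity D A, P.Corresponds S) ∧
      (∀ (A B : Type v) (P : Affinity D A) (S : D.theory.Model A)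
        (Q : Affinity D B) (S' : D.theory.Model B),
        P.Corresponds S → Q.Corresponds S' →
          ∀ φ : A → B, AlgTheory.IsModelHom S S' φ ↔ P.IsHom Q φ)) := by
  have hD (D : LeftLinearForm.{u}) :
      AlgTheory.abelianMaltsev (LeftLinearForm.theoryFunctor.obj D) := D.abelianMaltsev_theory
  refine ⟨⟨hD, ?_⟩, fun D => ⟨fun A P => ?_, fun A S => ?_, ?_⟩⟩
  · have := LeftLinearForm.essSurj_lift_theoryFunctor hD
    -- Fullness and faithfulness pass from `theoryFunctor` to its lift to the full subcategory.
    exact { }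
  · exact ⟨P.toModel, P.corresponds_toModel, fun S h => h.eq_toModel⟩
  · exact ⟨LeftLinearForm.toAffinity S, LeftLinearForm.corresponds_toAffinity S,
      fun P h => h.eq_toAffinity⟩
  · exact fun A B P S Q S' h h' φ => Affinity.isModelHom_iff_isHom h h' φ
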